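/- **Conventions.** A digraph $\Gamma$ is a finite nonempty vertex set $V(\Gamma)$ together with a set $A(\Gamma)$ of arcs, i.e. ordered pairs of distinct vertices. It is *undirected* if $A(\Gamma)$ is a symmetric relation. In a strongly connected digraph, $\partial_\Gamma(x,y)$ is the length of a shortest directed path from $x$ to $y$, $\tilde\partial_\Gamma(x,y)=(\partial_\Gamma(x,y),\partial_\Gamma(y,x))$ is the two-way distance, and $\tilde\partial(\Gamma)$ is the set of all two-way distances that occur. A strongly connected digraph $\Gamma$ is *weakly distance-regular* if for all $\tilde h,\tilde i,\tilde j\in\tilde\partial(\Gamma)$ the number of vertices $z$ with $\tilde\partial_\Gamma(x,z)=\tilde i$ and $\tilde\partial_\Gamma(z,y)=\tilde j$ is a constant $p^{\tilde h}_{\tilde i,\tilde j}$ for all $x,y$ with $\tilde\partial_\Gamma(x,y)=\tilde h$; it is *commutative* if $p^{\tilde h}_{\tilde i,\tilde j}=p^{\tilde h}_{\tilde j,\tilde i}$ for all $\tilde h,\tilde i,\tilde j\in\tilde\partial(\Gamma)$. The *underlying graph* of $\Gamma$ has vertex set $V(\Gamma)$, with $x,y$ adjacent if and only if $(x,y)\in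 A(\Gamma)$ or $(y,x)\in A(\Gamma)$. $\mathrm{Cay}(G,S)$ is the digraph on the additive group $G$ with an arc $(x,y)$ if and only if $y-x\in S$. The *Shrikhande graph* is $\mathrm{Cay}(\mathbb Z_4\times\mathbb Z_4,\{(\pm1,0),(0,\pm1),\pm(1,1)\})$. The Hamming graph $H(d,4)$ has as vertices the words of length $d$ over a $4$-letter alphabet, adjacent if and only if they differ in exactly one coordinate ($H(0,4)$ is a single vertex). For integers $d_1>0$ and $d_2\ge 0$, the *Doob graph* $G(d_1,d_2)$ is the Cartesian product of $H(d_2,4)$ with $d_1$ copies of the Shrikhande graph. **Theorem 1.3.** Let $\Gamma$ be a commutative weakly distance-regular digraph that is not undirected. Then the underlying graph of $\Gamma$ is isomorphic to a Doob graph $G(d_1,d_2)$ for some $d_1>0$, $d_2\ge0$ if and only if $\Gamma$ is isomorphic to $\mathrm{Cay}(\mathbb Z_4\times\mathbb Z_4,\{(1,0),(0,1),(-1,-1)\})$. Moreover, whenever the underlying graph of $\Gamma$ is isomorphic to $G(d_1,d_2)$ with $d_1>0$, $d_2\ge0$, one has $d_1=1$ and $d_2=0$, and the underlying graph is isomorphic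 to the Shrikhande graph. -/

import Mathlib

namespace Digraph

variable {V : Type*}

/-- There is a path of length `r` from `x` to `y`: vertices `x = w₀, w₁, …, w_r = y` such that each
`(w_{t-1}, w_t)` is an arc. -/
def HasPathOfLength (Γ : Digraph V) : ℕ → V → V → Prop
  | 0, x, y => x = y
  | r + 1, x, y => ∃ z, Γ.Adj x z ∧ HasPathOfLength Γ r z y

/-- Any two vertices are joined by a path, in both directions. -/
def StronglyConnected (Γ : Digraph V) : Prop :=
  ∀ x y, ∃ r, Γ.HasPathOfLength r x y

/-- The length of a shortest path from `x` to `y` (only used for strongly connected digraphs;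
the value is `0` if there is no path). -/
noncomputable def dist (Γ : Digraph V) (x y : V) : ℕ :=
  sInf {r | Γ.HasPathOfLength r x y}

/-- The two-way distance `(∂(x, y), ∂(y, x))`. -/
noncomputable def twoWayDist (Γ : Digraph V) (x y : V) : ℕ × ℕ :=
  (Γ.dist x y, Γ.dist y x)

/-- The set of all two-way distances that occur in `Γ`. -/
def twoWayDistSet (Γ : Digraph V) : Set (ℕ × ℕ) :=
  {h | ∃ x y, Γ.twoWayDist x y = h}

/-- The number of vertices `z` at two-way distance `i` from `x` such that `y` is at two-way
distance `j` from `z`. -/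
noncomputable def pathCount (Γ : Digraph V) (i j : ℕ × ℕ) (x y : V) : ℕ :=
  {z | Γ.twoWayDist x z = i ∧ Γ.twoWayDist z y = j}.ncard

/-- A strongly connected digraph is weakly distance-regular if for all two-way distances `h, i, j`
the number `Γ.pathCount i j x y` is the same for all `(x, y)` at two-way distance `h`. -/
def IsWeaklyDistanceRegular (Γ : Digraph V) : Prop :=
  Γ.StronglyConnected ∧
    ∀ h ∈ Γ.twoWayDistSet, ∀ i ∈ Γ.twoWayDistSet, ∀ j ∈ Γ.twoWayDistSet,
      ∃ p : ℕ, ∀ x y, Γ.twoWayDist x y = h → Γ.pathCount i j x y = p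

/-- Commutativity `p^h_{i,j} = p^h_{j,i}`, where `p^h_{i,j}` is the common value of
`Γ.pathCount i j x y` over all `(x, y)` at two-way distance `h`. -/
def IsCommutative (Γ : Digraph V) : Prop :=
  ∀ h ∈ Γ.twoWayDistSet, ∀ i ∈ Γ.twoWayDistSet, ∀ j ∈ Γ.twoWayDistSet,
    ∀ x y, Γ.twoWayDist x y = h → Γ.pathCount i j x y = Γ.pathCount j i x y

/-- The Cayley digraph `Cay(G, S)` of an additive group: `(x, y)` is an arc iff `y - x ∈ S`. -/
def addCayley {G : Type*} [AddGroup G] (S : Set G) : Digraph G where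
  Adj x y := -x + y ∈ S

end Digraph

/-- The Shrikhande graph `Cay(ℤ₄ × ℤ₄, {±(1,0), ±(0,1), ±(1,1)})`. -/
def shrikhandeGraph : SimpleGraph (ZMod 4 × ZMod 4) :=
  SimpleGraph.addCayley {(1, 0), (-1, 0), (0, 1), (0, -1), (1, 1), (-1, -1)}

/-- The Cartesian product of `n` copies of the graph `G`. -/
def SimpleGraph.boxPow {V : Type*} (G : SimpleGraph V) (n : ℕ) : SimpleGraph (Fin n → V) where
  Adj x y := ∃ i, G.Adj (x i) (y i) ∧ ∀ j, j ≠ i → x j = y j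
  symm := ⟨fun _ _ ⟨i, h, h'⟩ => ⟨i, h.symm, fun j hj => (h' j hj).symm⟩⟩
  loopless := ⟨fun _ ⟨_, h, _⟩ => h.ne rfl⟩

/-- The Hamming graph `H(d, q)`: words of length `d` over an alphabet of `q` letters, adjacent iff
they differ in exactly one coordinate. -/
def hammingGraph (d q : ℕ) : SimpleGraph (Fin d → Fin q) where
  Adj x y := hammingDist x y = 1
  symm := ⟨fun x y h => by rwa [hammingDist_comm]⟩
  loopless := ⟨fun x h => by simp at h⟩

/-- `G(d₁, d₂)`, the Cartesian product of `H(d₂, 4)` with `d₁` copies of the Shrikhande graph;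
it is a Doob graph when `0 < d₁`. -/
def doobGraph (d₁ d₂ : ℕ) :
    SimpleGraph ((Fin d₂ → Fin 4) × (Fin d₁ → ZMod 4 × ZMod 4)) :=
  (hammingGraph d₂ 4).boxProd (shrikhandeGraph.boxPow d₁)

/-!
Write `t x y` for the two-way distance, and let the underlying graph be a Doob graph. Any two
adjacent vertices have exactly two common neighbours in it, and so have two vertices at distance
two. For `x, y` with exactly two common neighbours `z, w`, commutativity leaves two possibilities
(`path_types`): the types along `x, w, y` are those along `x, z, y` in reversed order, or each of
the two paths has a constant type. Hence (`quadrangle`) in a 4-cycle both of whose diagonal pairs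
have no further common neighbours, opposite edges have equal types, or the 4-cycle is a directed
one of constant type.

*One Shrikhande fibre.* A directed rhombus `x, z, y, w` of constant asymmetric type on an edge `x y`
would have type `(1, 2)` and an undirected chord `x y`. Then the types `(1, 1)`, `(1, 2)`, `(2, 1)`
follow one another cyclically around each vertex, opposite neighbours have equal types, and a
4-cycle `a, a + u, a + 2u, a - u` contradicts `path_types`. So all rhombi are parallel and the type of
`(a, a + s)` depends on `s` only (`translation_invariant`). As `2s = -2s`, all pairs `(a, a + 2s)`
are at two-way distance `(2, 2)`, and comparing the paths of length two between them shows
(`fibre_types`) that the fibre is undirected, or is the Cayley digraph of the connection set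
`{(1, 0), (0, 1), (-1, -1)}` or its negative, with all arcs of type `(1, 2)`.

*Undirected fibres.* If one Shrikhande fibre is undirected, then counting undirected paths of length
two between vertices at two-way distance `(2, 2)` or `(1, 1)` shows that all other Shrikhande fibres
are undirected, and that a complete fibre on four vertices is undirected if one of its edges is.
A complete fibre cannot be a tournament (`exists_undirected_of_complete`), so the whole digraph is
undirected (`symm_of_undirected_fibre`).

*Directed fibres.* Otherwise translations along the fibre are automorphisms (`cross_parallel`), and
`Γ` is the Cartesian product of the Cayley digraph and a digraph `D` (`isBoxProd`), so that
distances add up. Comparing pairs at two-way distance `(3, 3)` inside the fibre with such pairs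
outside shows that `D` has no undirected edges (`twoWayDist_ne_one_one`) and no arcs of type
`(1, 2)` (`dist_ne_two_of_adj`). But every edge lies in a Shrikhande fibre or a complete fibre,
which leaves no possible arc for `D`: it has a single vertex (`eq_of_directed_fibre`).
-/

namespace Digraph

/-! ### Two-way distances of small length -/

section Basic

variable {V : Type*} {Γ : Digraph V}

theorem twoWayDist_swap (Γ : Digraph V) (x y : V) :
    (Γ.twoWayDist x y).swap = Γ.twoWayDist y x := rfl

theorem dist_le_of_hasPath {r : ℕ} {x y : V} (h : Γ.HasPathOfLength r x y) : Γ.dist x y ≤ r :=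
  Nat.sInf_le h

theorem StronglyConnected.hasPath_dist (hs : Γ.StronglyConnected) (x y : V) :
    Γ.HasPathOfLength (Γ.dist x y) x y :=
  Nat.sInf_mem (s := {r | Γ.HasPathOfLength r x y}) (hs x y)

theorem dist_self (Γ : Digraph V) (x : V) : Γ.dist x x = 0 :=
  Nat.le_zero.1 (dist_le_of_hasPath (r := 0) rfl)

theorem StronglyConnected.dist_eq_zero (hs : Γ.StronglyConnected) {x y : V} :
    Γ.dist x y = 0 ↔ x = y := by
  constructor
  · intro h
    have := hs.hasPath_dist x y
    rwa [h] at this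
  · rintro rfl
    exact dist_self Γ x

theorem hasPath_one {x y : V} : Γ.HasPathOfLength 1 x y ↔ Γ.Adj x y := by
  simp [HasPathOfLength]

theorem hasPath_two {x y : V} : Γ.HasPathOfLength 2 x y ↔ ∃ z, Γ.Adj x z ∧ Γ.Adj z y := by
  simp [HasPathOfLength]

theorem dist_le_two {x y z : V} (h : Γ.Adj x z) (h' : Γ.Adj z y) : Γ.dist x y ≤ 2 :=
  dist_le_of_hasPath (hasPath_two.2 ⟨z, h, h'⟩)

theorem StronglyConnected.dist_eq_one (hs : Γ.StronglyConnected) (hl : ∀ x, ¬ Γ.Adj x x)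
    {x y : V} : Γ.dist x y = 1 ↔ Γ.Adj x y := by
  constructor
  · intro h
    have := hs.hasPath_dist x y
    rwa [h, hasPath_one] at this
  · intro h
    have h1 := dist_le_of_hasPath (hasPath_one.2 h)
    have h0 : Γ.dist x y ≠ 0 := fun h0 => by
      rw [hs.dist_eq_zero] at h0
      exact hl x (by rwa [← h0] at h)
    omega

theorem StronglyConnected.dist_eq_two (hs : Γ.StronglyConnected) (hl : ∀ x, ¬ Γ.Adj x x)
    {x y z : V} (h : Γ.Adj x z) (h' : Γ.Adj z y) (hne : x ≠ y) (hadj : ¬ Γ.Adj x y) :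
    Γ.dist x y = 2 := by
  have h2 := dist_le_two h h'
  have h0 := mt hs.dist_eq_zero.1 hne
  have h1 := mt (hs.dist_eq_one hl).1 hadj
  omega

end Basic

/-- The hypotheses on `Γ` that are in force throughout: a commutative weakly distance-regular
digraph without loops. -/
structure IsCommWDR {V : Type*} (Γ : Digraph V) : Prop where
  loopless : ∀ x, ¬ Γ.Adj x x
  wdr : Γ.IsWeaklyDistanceRegular
  comm : Γ.IsCommutative

namespace IsCommWDR

variable {V : Type*} {Γ : Digraph V}

theorem dist_eq_one (hΓ : Γ.IsCommWDR) {x y : V} : Γ.dist x y = 1 ↔ Γ.Adj x y :=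
  hΓ.wdr.1.dist_eq_one hΓ.loopless

theorem fst_eq_one (hΓ : Γ.IsCommWDR) {x y : V} : (Γ.twoWayDist x y).1 = 1 ↔ Γ.Adj x y :=
  hΓ.dist_eq_one

theorem snd_eq_one (hΓ : Γ.IsCommWDR) {x y : V} : (Γ.twoWayDist x y).2 = 1 ↔ Γ.Adj y x :=
  hΓ.dist_eq_one

theorem underlying_adj (hΓ : Γ.IsCommWDR) {x y : V} : Γ.toSimpleGraphInclusive.Adj x y ↔
    (Γ.twoWayDist x y).1 = 1 ∨ (Γ.twoWayDist x y).2 = 1 := by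
  rw [hΓ.fst_eq_one, hΓ.snd_eq_one, toSimpleGraphInclusive, SimpleGraph.fromRel_adj]
  refine ⟨fun h => h.2, fun h => ⟨?_, h⟩⟩
  rintro rfl
  exact hΓ.loopless x (h.elim id id)

end IsCommWDR
end Digraph

namespace Digraph.IsCommWDR

/-! ### Transfer of paths and quadrangles -/

variable {V : Type*} {Γ : Digraph V}

/-- Weak distance-regularity, in the form in which it is used: a path of type `(i, j)` between two
vertices gives one between any two vertices at the same two-way distance. -/
theorem exists_transfer [Finite V] (hΓ : Γ.IsCommWDR) {x y z x' y' : V} {i j : ℕ × ℕ}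
    (hi : Γ.twoWayDist x z = i) (hj : Γ.twoWayDist z y = j)
    (h : Γ.twoWayDist x' y' = Γ.twoWayDist x y) :
    ∃ z', Γ.twoWayDist x' z' = i ∧ Γ.twoWayDist z' y' = j := by
  obtain ⟨p, hp⟩ := hΓ.wdr.2 _ ⟨x, y, rfl⟩ i ⟨x, z, hi⟩ j ⟨z, y, hj⟩
  have h1 := hp x y rfl
  have h2 := hp x' y' h
  have h3 : Γ.pathCount i j x y ≠ 0 := by
    rw [pathCount, Ne, Set.ncard_eq_zero]
    exact Set.Nonempty.ne_empty ⟨z, hi, hj⟩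
  rw [h1, ← h2] at h3
  exact Set.nonempty_of_ncard_ne_zero h3

/-- The same for two different paths of type `(i, j)`. -/
theorem exists_transfer_two [Finite V] (hΓ : Γ.IsCommWDR) {x y z w x' y' : V} {i j : ℕ × ℕ}
    (hzw : z ≠ w) (hi : Γ.twoWayDist x z = i) (hj : Γ.twoWayDist z y = j)
    (hi' : Γ.twoWayDist x w = i) (hj' : Γ.twoWayDist w y = j)
    (h : Γ.twoWayDist x' y' = Γ.twoWayDist x y) :
    ∃ z' w', z' ≠ w' ∧ (Γ.twoWayDist x' z' = i ∧ Γ.twoWayDist z' y' = j) ∧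
      (Γ.twoWayDist x' w' = i ∧ Γ.twoWayDist w' y' = j) := by
  obtain ⟨p, hp⟩ := hΓ.wdr.2 _ ⟨x, y, rfl⟩ i ⟨x, z, hi⟩ j ⟨z, y, hj⟩
  have h1 := hp x y rfl
  have h2 := hp x' y' h
  have h3 : 1 < Γ.pathCount i j x y := by
    rw [pathCount, Set.one_lt_ncard_iff]
    exact ⟨z, w, ⟨hi, hj⟩, ⟨hi', hj'⟩, hzw⟩
  rw [h1, ← h2, pathCount, Set.one_lt_ncard_iff] at h3
  obtain ⟨a, b, ha, hb, hab⟩ := h3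
  exact ⟨a, b, hab, ha, hb⟩

theorem exists_swap [Finite V] (hΓ : Γ.IsCommWDR) {x y z : V} {i j : ℕ × ℕ}
    (hi : Γ.twoWayDist x z = i) (hj : Γ.twoWayDist z y = j) :
    ∃ z', Γ.twoWayDist x z' = j ∧ Γ.twoWayDist z' y = i := by
  have h := hΓ.comm _ ⟨x, y, rfl⟩ i ⟨x, z, hi⟩ j ⟨z, y, hj⟩ x y rfl
  have h3 : Γ.pathCount i j x y ≠ 0 := by
    rw [pathCount, Ne, Set.ncard_eq_zero]
    exact Set.Nonempty.ne_empty ⟨z, hi, hj⟩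
  rw [h] at h3
  exact Set.nonempty_of_ncard_ne_zero h3

/-- A path whose two steps have the types of two edges passes through a common neighbour. -/
theorem mem_commonNeighbors (hΓ : Γ.IsCommWDR) {x y z a b c d : V}
    (hab : Γ.toSimpleGraphInclusive.Adj a b) (hcd : Γ.toSimpleGraphInclusive.Adj c d)
    (hi : Γ.twoWayDist x z = Γ.twoWayDist a b) (hj : Γ.twoWayDist z y = Γ.twoWayDist c d) :
    z ∈ Γ.toSimpleGraphInclusive.commonNeighbors x y := by
  rw [SimpleGraph.mem_commonNeighbors, Γ.toSimpleGraphInclusive.adj_comm y z]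
  simp only [hΓ.underlying_adj] at hab hcd ⊢
  rw [hi, hj]
  exact ⟨hab, hcd⟩

/-- Transfer between pairs with given common neighbours. -/
theorem exists_transfer_mem [Finite V] (hΓ : Γ.IsCommWDR) {x y z x' y' a b : V}
    (hz : z ∈ Γ.toSimpleGraphInclusive.commonNeighbors x y)
    (h : Γ.twoWayDist x' y' = Γ.twoWayDist x y)
    (hab : Γ.toSimpleGraphInclusive.commonNeighbors x' y' = {a, b}) :
    (Γ.twoWayDist x' a = Γ.twoWayDist x z ∧ Γ.twoWayDist a y' = Γ.twoWayDist z y) ∨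
      (Γ.twoWayDist x' b = Γ.twoWayDist x z ∧ Γ.twoWayDist b y' = Γ.twoWayDist z y) := by
  obtain ⟨z', h1, h2⟩ := hΓ.exists_transfer rfl rfl h (z := z)
  have := hΓ.mem_commonNeighbors hz.1 hz.2.symm h1 h2
  rw [hab] at this
  rcases this with rfl | rfl
  · exact Or.inl ⟨h1, h2⟩
  · exact Or.inr ⟨h1, h2⟩

/-- If `z, w` are the only common neighbours of `x, y`, then commutativity says that the types along
`x, w, y` are those along `x, z, y` in the opposite order, or each of the two paths has a constant
type. -/
theorem path_types [Finite V] (hΓ : Γ.IsCommWDR) {x y z w : V}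
    (h : Γ.toSimpleGraphInclusive.commonNeighbors x y = {z, w}) :
    (Γ.twoWayDist x z = Γ.twoWayDist w y ∧ Γ.twoWayDist z y = Γ.twoWayDist x w) ∨
      (Γ.twoWayDist x z = Γ.twoWayDist z y ∧ Γ.twoWayDist x w = Γ.twoWayDist w y) := by
  have key : ∀ z w, Γ.toSimpleGraphInclusive.commonNeighbors x y = {z, w} →
      Γ.twoWayDist x z ≠ Γ.twoWayDist z y →
      Γ.twoWayDist x z = Γ.twoWayDist w y ∧ Γ.twoWayDist z y = Γ.twoWayDist x w := by
    intro z w h hne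
    have hz : z ∈ Γ.toSimpleGraphInclusive.commonNeighbors x y := by simp [h]
    obtain ⟨v, h1, h2⟩ := hΓ.exists_swap (Γ := Γ) (x := x) (z := z) (y := y) rfl rfl
    have := hΓ.mem_commonNeighbors hz.2.symm hz.1 h1 h2
    rw [h] at this
    rcases this with rfl | rfl
    · exact absurd h1 hne
    · exact ⟨h2.symm, h1.symm⟩
  by_cases h1 : Γ.twoWayDist x z = Γ.twoWayDist z y
  · by_cases h2 : Γ.twoWayDist x w = Γ.twoWayDist w y
    · exact Or.inr ⟨h1, h2⟩
    · obtain ⟨h3, h4⟩ := key w z (by rw [h, Set.pair_comm]) h2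
      exact Or.inl ⟨h4.symm, h3.symm⟩
  · exact Or.inl (key z w h h1)

/-- In a quadrangle whose diagonal pairs have no further common neighbours, opposite edges have the
same type, or the quadrangle is a directed 4-cycle all of whose edges have the same type. -/
theorem quadrangle [Finite V] (hΓ : Γ.IsCommWDR) {x y z w : V}
    (h : Γ.toSimpleGraphInclusive.commonNeighbors x y = {z, w})
    (h' : Γ.toSimpleGraphInclusive.commonNeighbors z w = {x, y}) :
    (Γ.twoWayDist x z = Γ.twoWayDist w y ∧ Γ.twoWayDist z y = Γ.twoWayDist x w) ∨
      (Γ.twoWayDist z y = Γ.twoWayDist x z ∧ Γ.twoWayDist y w = Γ.twoWayDist x z ∧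
        Γ.twoWayDist w x = Γ.twoWayDist x z) := by
  have h1 := hΓ.path_types h
  have h2 := hΓ.path_types h'
  simp only [twoWayDist, Prod.mk.injEq] at *
  omega

/-- In a directed 4-cycle of constant asymmetric type with a chord, the type is `(1, 2)` and the
chord is undirected, provided that one more pair of common neighbours is known. This is the case
where an arc runs along the chord. -/
theorem chord_type_of_adj [Finite V] (hΓ : Γ.IsCommWDR) {x y z w b : V} {i : ℕ × ℕ}
    (hxz : Γ.twoWayDist x z = i) (hzy : Γ.twoWayDist z y = i) (hyw : Γ.twoWayDist y w = i)
    (hwx : Γ.twoWayDist w x = i) (hi : i.1 = 1) (hi' : i ≠ i.swap)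
    (hb : Γ.toSimpleGraphInclusive.commonNeighbors z y = {x, b})
    (hxy : Γ.Adj x y) : i = (1, 2) ∧ Γ.twoWayDist x y = (1, 1) := by
  have axz : Γ.Adj x z := hΓ.fst_eq_one.1 (by rw [hxz, hi])
  have azy : Γ.Adj z y := hΓ.fst_eq_one.1 (by rw [hzy, hi])
  have ayw : Γ.Adj y w := hΓ.fst_eq_one.1 (by rw [hyw, hi])
  have awx : Γ.Adj w x := hΓ.fst_eq_one.1 (by rw [hwx, hi])
  have nwy : ¬ Γ.Adj w y := by
    rw [← hΓ.snd_eq_one, hyw]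
    intro h
    exact hi' (Prod.ext (by simp [hi, h]) (by simp [hi, h]))
  have hi2 : i = (1, 2) := by
    refine Prod.ext hi ?_
    rw [← hyw]
    exact hΓ.wdr.1.dist_eq_two hΓ.loopless awx hxy (fun h => hΓ.loopless w (h ▸ ayw)) nwy
  subst hi2
  refine ⟨rfl, ?_⟩
  by_cases hyx : Γ.Adj y x
  · exact Prod.ext (hΓ.fst_eq_one.2 hxy) (hΓ.snd_eq_one.2 hyx)
  -- otherwise the chord has the type `(1, 2)` of the other edges, so that the number of paths of
  -- type `((1, 2), (1, 2))` between `z` and `y` is positive, which does not fit with `z, x, y`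
  exfalso
  have h12 : Γ.twoWayDist x y = (1, 2) :=
    Prod.ext (hΓ.fst_eq_one.2 hxy)
      (hΓ.wdr.1.dist_eq_two hΓ.loopless ayw awx (fun h => hΓ.loopless x (h ▸ hxy)) hyx)
  have hadj : Γ.toSimpleGraphInclusive.Adj x z := hΓ.underlying_adj.2 (by simp [hxz])
  have hadj' : Γ.toSimpleGraphInclusive.Adj z y := hΓ.underlying_adj.2 (by simp [hzy])
  have h1 := hΓ.exists_transfer_mem (x := x) (y := y) (z := z) ⟨hadj, hadj'.symm⟩
    (hzy.trans h12.symm) hb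
  have h2 := hΓ.path_types hb
  rw [← twoWayDist_swap Γ x z, hxz, hzy, h12] at *
  rcases h1 with h1 | h1
  · simp at h1
  · rw [h1.1, h1.2] at h2
    simp at h2

theorem chord_type [Finite V] (hΓ : Γ.IsCommWDR) {x y z w b b' : V} {i : ℕ × ℕ}
    (hxz : Γ.twoWayDist x z = i) (hzy : Γ.twoWayDist z y = i) (hyw : Γ.twoWayDist y w = i)
    (hwx : Γ.twoWayDist w x = i) (hi : i.1 = 1) (hi' : i ≠ i.swap)
    (hb : Γ.toSimpleGraphInclusive.commonNeighbors z y = {x, b})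
    (hb' : Γ.toSimpleGraphInclusive.commonNeighbors w x = {y, b'})
    (hxy : Γ.toSimpleGraphInclusive.Adj x y) : i = (1, 2) ∧ Γ.twoWayDist x y = (1, 1) := by
  rcases hΓ.underlying_adj.1 hxy with h | h
  · exact hΓ.chord_type_of_adj hxz hzy hyw hwx hi hi' hb (hΓ.fst_eq_one.1 h)
  · obtain ⟨h1, h2⟩ := hΓ.chord_type_of_adj hyw hwx hxz hzy hi hi' hb' (hΓ.snd_eq_one.1 h)
    refine ⟨h1, ?_⟩
    rw [← twoWayDist_swap Γ y x, h2]
    rfl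

end Digraph.IsCommWDR

/-! ### The Shrikhande graph -/

namespace Shrikhande

/-- The six neighbours of `0` in the Shrikhande graph; they induce a hexagon. -/
def hexagon : Finset (ZMod 4 × ZMod 4) := {(1, 0), (-1, 0), (0, 1), (0, -1), (1, 1), (-1, -1)}

/-- The automorphism of `ℤ₄ × ℤ₄` of order six that rotates the hexagon by one step. -/
def rot (p : ZMod 4 × ZMod 4) : ZMod 4 × ZMod 4 := (p.1 - p.2, p.1)

/-- The inverse of `rot`. -/
def rotInv (p : ZMod 4 × ZMod 4) : ZMod 4 × ZMod 4 := (p.2, p.2 - p.1)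

theorem adj_iff {a b : ZMod 4 × ZMod 4} : shrikhandeGraph.Adj a b ↔ b - a ∈ hexagon := by
  have key : ∀ c : ZMod 4 × ZMod 4, (0 ≠ c ∧ ((∃ g ∈ hexagon, 0 + g = c) ∨
      ∃ g ∈ hexagon, c + g = 0)) ↔ c ∈ hexagon := by decide
  rw [← key, shrikhandeGraph, SimpleGraph.addCayley, SimpleGraph.fromRel_adj]
  refine and_congr ?_ (or_congr ?_ ?_)
  · rw [ne_comm, ne_eq, ← sub_eq_zero, ne_comm]
  · simp [hexagon, eq_sub_iff_add_eq']
  · simp [hexagon, sub_eq_iff_eq_add, sub_add_eq_add_sub]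

theorem rot_mem {s : ZMod 4 × ZMod 4} (hs : s ∈ hexagon) : rot s ∈ hexagon := by
  revert s; decide

theorem rotInv_mem {s : ZMod 4 × ZMod 4} (hs : s ∈ hexagon) : rotInv s ∈ hexagon := by
  revert s; decide

theorem neg_mem {s : ZMod 4 × ZMod 4} (hs : s ∈ hexagon) : -s ∈ hexagon := by
  revert s; decide

theorem ne_zero_of_mem {s : ZMod 4 × ZMod 4} (hs : s ∈ hexagon) : s ≠ 0 := by
  revert s; decide

theorem rot_add_rotInv (s : ZMod 4 × ZMod 4) : rot s + rotInv s = s := by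
  ext <;> simp [rot, rotInv]

theorem rot_rotInv (s : ZMod 4 × ZMod 4) : rot (rotInv s) = s := by
  ext <;> simp [rot, rotInv]

theorem rotInv_rot (s : ZMod 4 × ZMod 4) : rotInv (rot s) = s := by
  ext <;> simp [rot, rotInv]

theorem rot_rot (s : ZMod 4 × ZMod 4) : rot (rot s) = -rotInv s := by
  ext <;> simp [rot, rotInv]

theorem rotInv_rotInv (s : ZMod 4 × ZMod 4) : rotInv (rotInv s) = -rot s := by
  ext <;> simp [rot, rotInv]

theorem adj_add_iff {a s : ZMod 4 × ZMod 4} : shrikhandeGraph.Adj a (a + s) ↔ s ∈ hexagon := by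
  rw [adj_iff, add_sub_cancel_left]

theorem commonNeighbors_eq {g p q : ZMod 4 × ZMod 4} (a : ZMod 4 × ZMod 4)
    (h : ∀ c, c ∈ hexagon ∧ c - g ∈ hexagon ↔ c = p ∨ c = q) :
    shrikhandeGraph.commonNeighbors a (a + g) = {a + p, a + q} := by
  ext b
  have := h (b - a)
  rw [SimpleGraph.mem_commonNeighbors, adj_iff, adj_iff]
  rw [sub_sub] at this
  rw [this, sub_eq_iff_eq_add', sub_eq_iff_eq_add']
  rfl

theorem commonNeighbors_edge {s : ZMod 4 × ZMod 4} (hs : s ∈ hexagon) (a : ZMod 4 × ZMod 4) :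
    shrikhandeGraph.commonNeighbors a (a + s) = {a + rot s, a + rotInv s} := by
  apply commonNeighbors_eq
  revert s; decide

theorem commonNeighbors_rot {s : ZMod 4 × ZMod 4} (hs : s ∈ hexagon) (a : ZMod 4 × ZMod 4) :
    shrikhandeGraph.commonNeighbors (a + rot s) (a + rotInv s) = {a, a + s} := by
  have := commonNeighbors_eq (g := rotInv s - rot s) (p := - rot s) (q := rotInv s) (a + rot s)
    (by revert s; decide)
  rw [add_neg_cancel_right, add_assoc a, add_assoc a, rot_add_rotInv, add_sub_cancel] at this
  exact this

theorem commonNeighbors_double {s : ZMod 4 × ZMod 4} (hs : s ∈ hexagon) (a : ZMod 4 × ZMod 4) :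
    shrikhandeGraph.commonNeighbors a (a + s + s) = {a + s, a - s} := by
  rw [add_assoc, sub_eq_add_neg]
  apply commonNeighbors_eq
  revert s; decide

end Shrikhande

/-! ### Fibres of Cartesian products -/

/-- `F` embeds the graph `G` into `H` like a fibre of a Cartesian product: as an induced subgraph
such that every vertex with two neighbours in it belongs to it. -/
structure IsFibre {A V : Type*} (G : SimpleGraph A) (H : SimpleGraph V) (F : A → V) : Prop where
  injective : Function.Injective F
  adj_iff : ∀ a b, H.Adj (F a) (F b) ↔ G.Adj a b
  mem_range : ∀ a b, a ≠ b → ∀ z, H.Adj (F a) z → H.Adj (F b) z → z ∈ Set.range F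

theorem IsFibre.commonNeighbors {A V : Type*} {G : SimpleGraph A} {H : SimpleGraph V} {F : A → V}
    (hF : IsFibre G H F) {a b : A} (hab : a ≠ b) :
    H.commonNeighbors (F a) (F b) = F '' G.commonNeighbors a b := by
  ext z
  constructor
  · rintro ⟨h1, h2⟩
    obtain ⟨c, rfl⟩ := hF.mem_range a b hab z h1 h2
    exact ⟨c, ⟨(hF.adj_iff _ _).1 h1, (hF.adj_iff _ _).1 h2⟩, rfl⟩
  · rintro ⟨c, ⟨h1, h2⟩, rfl⟩
    exact ⟨(hF.adj_iff _ _).2 h1, (hF.adj_iff _ _).2 h2⟩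

theorem isFibre_of_boxProd_iso {A W V : Type*} {G : SimpleGraph A} {K : SimpleGraph W}
    {H : SimpleGraph V} (e : G.boxProd K ≃g H) (w : W) : IsFibre G H (fun a => e (a, w)) where
  injective a b h := by simpa using h
  adj_iff a b := by
    rw [e.map_adj_iff]
    simp
  mem_range a b hab z h1 h2 := by
    obtain ⟨⟨c, w'⟩, rfl⟩ := e.surjective z
    rw [e.map_adj_iff, SimpleGraph.boxProd_adj] at h1 h2
    simp only at h1 h2
    have : w = w' := by
      rcases h1 with h1 | h1
      · exact h1.2
      · rcases h2 with h2 | h2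
        · exact h2.2
        · exact absurd (h1.2.trans h2.2.symm) hab
    subst this
    exact ⟨c, rfl⟩

/-- `H.HasDoobFibres`: every edge lies in a fibre that is a Shrikhande graph or a complete graph on
four vertices. -/
def SimpleGraph.HasDoobFibres {V : Type*} (H : SimpleGraph V) : Prop :=
  ∀ x y, H.Adj x y →
    (∃ F : ZMod 4 × ZMod 4 → V, IsFibre shrikhandeGraph H F ∧ x ∈ Set.range F ∧ y ∈ Set.range F) ∨
    (∃ K : Fin 4 → V, IsFibre ⊤ H K ∧ x ∈ Set.range K ∧ y ∈ Set.range K)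

namespace Digraph.IsCommWDR

open Shrikhande

/-! ### Translation invariance of Shrikhande fibres -/

section Fibre

variable {V : Type*} {Γ : Digraph V} {F : ZMod 4 × ZMod 4 → V}

theorem commonNeighbors_edge (hF : IsFibre shrikhandeGraph Γ.toSimpleGraphInclusive F)
    {s : ZMod 4 × ZMod 4} (hs : s ∈ hexagon) (a : ZMod 4 × ZMod 4) :
    Γ.toSimpleGraphInclusive.commonNeighbors (F a) (F (a + s)) =
      {F (a + rot s), F (a + rotInv s)} := by
  rw [hF.commonNeighbors (by simpa using ne_zero_of_mem hs), Shrikhande.commonNeighbors_edge hs,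
    Set.image_pair]

theorem commonNeighbors_rot (hF : IsFibre shrikhandeGraph Γ.toSimpleGraphInclusive F)
    {s : ZMod 4 × ZMod 4} (hs : s ∈ hexagon) (a : ZMod 4 × ZMod 4) :
    Γ.toSimpleGraphInclusive.commonNeighbors (F (a + rot s)) (F (a + rotInv s)) =
      {F a, F (a + s)} := by
  rw [hF.commonNeighbors (by revert s; simp only [ne_eq, add_right_inj]; decide),
    Shrikhande.commonNeighbors_rot hs, Set.image_pair]

theorem double_ne_zero {s : ZMod 4 × ZMod 4} (hs : s ∈ hexagon) : s + s ≠ 0 := by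
  revert s; decide

theorem commonNeighbors_double (hF : IsFibre shrikhandeGraph Γ.toSimpleGraphInclusive F)
    {s : ZMod 4 × ZMod 4} (hs : s ∈ hexagon) (a : ZMod 4 × ZMod 4) :
    Γ.toSimpleGraphInclusive.commonNeighbors (F a) (F (a + s + s)) = {F (a + s), F (a - s)} := by
  rw [hF.commonNeighbors (by simpa [add_assoc] using double_ne_zero hs),
    Shrikhande.commonNeighbors_double hs, Set.image_pair]

theorem adj_fibre (hF : IsFibre shrikhandeGraph Γ.toSimpleGraphInclusive F)
    {s : ZMod 4 × ZMod 4} (hs : s ∈ hexagon) (a : ZMod 4 × ZMod 4) :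
    Γ.toSimpleGraphInclusive.Adj (F a) (F (a + s)) :=
  (hF.adj_iff _ _).2 (adj_add_iff.2 hs)

/-- If an undirected edge is the chord of a directed 4-cycle with edges of type `(1, 2)`, then the
types `(1, 1)`, `(1, 2)`, `(2, 1)` follow one another cyclically around the neighbourhood of a
vertex of a Shrikhande fibre. -/
theorem hexagon_types [Finite V] (hΓ : Γ.IsCommWDR)
    (hF : IsFibre shrikhandeGraph Γ.toSimpleGraphInclusive F) {x y z w : V}
    (hxy : Γ.twoWayDist x y = (1, 1)) (hxz : Γ.twoWayDist x z = (1, 2))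
    (hzy : Γ.twoWayDist z y = (1, 2)) (hyw : Γ.twoWayDist y w = (1, 2))
    (hwx : Γ.twoWayDist w x = (1, 2)) {s : ZMod 4 × ZMod 4} (hs : s ∈ hexagon)
    (a : ZMod 4 × ZMod 4) {l : ℕ × ℕ} (hl : Γ.twoWayDist (F a) (F (a + s)) = l)
    (hl' : l ∈ ({(1, 1), (1, 2), (2, 1)} : Finset (ℕ × ℕ))) :
    let r := Γ.twoWayDist (F a) (F (a + rot s))
    let r' := Γ.twoWayDist (F a) (F (a + rotInv s))
    r ∈ ({(1, 1), (1, 2), (2, 1)} : Finset (ℕ × ℕ)) ∧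
      r' ∈ ({(1, 1), (1, 2), (2, 1)} : Finset (ℕ × ℕ)) ∧ l ≠ r ∧ l ≠ r' ∧ r ≠ r' := by
  intro r r'
  have hyx : Γ.twoWayDist y x = (1, 1) := by rw [← twoWayDist_swap, hxy]; rfl
  have hzx : Γ.twoWayDist z x = (2, 1) := by rw [← twoWayDist_swap, hxz]; rfl
  have hyz : Γ.twoWayDist y z = (2, 1) := by rw [← twoWayDist_swap, hzy]; rfl
  have hwy : Γ.twoWayDist w y = (2, 1) := by rw [← twoWayDist_swap, hyw]; rfl
  have hxw : Γ.twoWayDist x w = (2, 1) := by rw [← twoWayDist_swap, hwx]; rfl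
  have Axy : Γ.toSimpleGraphInclusive.Adj x y := hΓ.underlying_adj.2 (by simp [hxy])
  have Axz : Γ.toSimpleGraphInclusive.Adj x z := hΓ.underlying_adj.2 (by simp [hxz])
  have Azy : Γ.toSimpleGraphInclusive.Adj z y := hΓ.underlying_adj.2 (by simp [hzy])
  have Axw : Γ.toSimpleGraphInclusive.Adj x w := hΓ.underlying_adj.2 (by simp [hxw])
  have Awy : Γ.toSimpleGraphInclusive.Adj w y := hΓ.underlying_adj.2 (by simp [hwy])
  have hcn := commonNeighbors_edge hF hs a
  have hp := hΓ.path_types hcn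
  simp only [Finset.mem_insert, Finset.mem_singleton] at hl'
  rcases hl' with rfl | rfl | rfl
  · have h1 := hΓ.exists_transfer_mem (x := x) (y := y) (z := z) ⟨Axz, Azy.symm⟩
      (hl.trans hxy.symm) hcn
    have h2 := hΓ.exists_transfer_mem (x := x) (y := y) (z := w) ⟨Axw, Awy.symm⟩
      (hl.trans hxy.symm) hcn
    rw [hxz, hzy] at h1
    rw [hxw, hwy] at h2
    rcases h1 with ⟨h1, -⟩ | ⟨h1, -⟩ <;> rcases h2 with ⟨h2, -⟩ | ⟨h2, -⟩ <;>
      simp_all [r, r']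
  · have h1 := hΓ.exists_transfer_mem (x := x) (y := z) (z := y) ⟨Axy, Azy⟩
      (hl.trans hxz.symm) hcn
    rw [hxy, hyz] at h1
    change r = _ ∧ _ ∨ r' = _ ∧ _ at h1
    change r = _ ∧ _ = r' ∨ r = _ ∧ r' = _ at hp
    clear_value r r'
    rcases h1 with ⟨rfl, h2⟩ | ⟨rfl, h2⟩ <;> rw [h2] at hp <;>
      rcases hp with ⟨h3, h4⟩ | ⟨h3, h4⟩
    · subst h4; decide
    · simp at h3
    · subst h3; decide
    · simp at h4
  · have h1 := hΓ.exists_transfer_mem (x := z) (y := x) (z := y) ⟨Azy, Axy⟩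
      (hl.trans hzx.symm) hcn
    rw [hzy, hyx] at h1
    change r = _ ∧ _ ∨ r' = _ ∧ _ at h1
    change r = _ ∧ _ = r' ∨ r = _ ∧ r' = _ at hp
    clear_value r r'
    rcases h1 with ⟨rfl, h2⟩ | ⟨rfl, h2⟩ <;> rw [h2] at hp <;>
      rcases hp with ⟨h3, h4⟩ | ⟨h3, h4⟩
    · subst h4; decide
    · simp at h3
    · subst h3; decide
    · simp at h4

/-- No Shrikhande fibre contains a directed 4-cycle of type `(1, 2)` around an undirected edge: the
types around each vertex would be invariant under negation, which contradicts commutativity on the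
4-cycle `a, a + u, a + 2u, a - u`. -/
theorem not_directed_rhombus [Finite V] (hΓ : Γ.IsCommWDR)
    (hF : IsFibre shrikhandeGraph Γ.toSimpleGraphInclusive F) {a u : ZMod 4 × ZMod 4} {y w : V}
    (hu : u ∈ hexagon)
    (hxy : Γ.twoWayDist (F a) y = (1, 1)) (hxz : Γ.twoWayDist (F a) (F (a + u)) = (1, 2))
    (hzy : Γ.twoWayDist (F (a + u)) y = (1, 2)) (hyw : Γ.twoWayDist y w = (1, 2))
    (hwx : Γ.twoWayDist w (F a) = (1, 2)) : False := by
  have antipodal : ∀ (b u : ZMod 4 × ZMod 4), u ∈ hexagon →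
      Γ.twoWayDist (F b) (F (b + u)) ∈ ({(1, 1), (1, 2), (2, 1)} : Finset (ℕ × ℕ)) →
      Γ.twoWayDist (F b) (F (b - u)) = Γ.twoWayDist (F b) (F (b + u)) := by
    intro b u hu hl
    obtain ⟨h1, -, h2, h3, h4⟩ := hΓ.hexagon_types hF hxy hxz hzy hyw hwx hu b rfl hl
    obtain ⟨h5, -, h6, h7, h8⟩ :=
      hΓ.hexagon_types hF hxy hxz hzy hyw hwx (rot_mem hu) b rfl h1
    obtain ⟨h9, -, h10, h11, h12⟩ :=
      hΓ.hexagon_types hF hxy hxz hzy hyw hwx (rot_mem (rot_mem hu)) b rfl h5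
    have e : rot (rot (rot u)) = -u := by rw [rot_rot, rotInv_rot]
    simp only [rotInv_rot, e, ← sub_eq_add_neg] at *
    generalize Γ.twoWayDist (F b) (F (b + u)) = p at *
    generalize Γ.twoWayDist (F b) (F (b - u)) = q at *
    generalize Γ.twoWayDist (F b) (F (b + rot u)) = r at *
    generalize Γ.twoWayDist (F b) (F (b + rot (rot u))) = r' at *
    simp only [Finset.mem_insert, Finset.mem_singleton] at *
    rcases hl with rfl | rfl | rfl <;> rcases h1 with rfl | rfl | rfl <;>
      rcases h5 with rfl | rfl | rfl <;> rcases h9 with rfl | rfl | rfl <;> simp_all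
  have h1 := antipodal a u hu (by rw [hxz]; decide)
  have hzx : Γ.twoWayDist (F (a + u)) (F (a + u - u)) = (2, 1) := by
    rw [add_sub_cancel_right, ← twoWayDist_swap, hxz]; rfl
  have h2 := antipodal (a + u) (-u) (neg_mem hu) (by rw [← sub_eq_add_neg, hzx]; decide)
  rw [sub_neg_eq_add, ← sub_eq_add_neg, hzx] at h2
  rw [hxz] at h1
  have h3 := hΓ.path_types (commonNeighbors_double hF hu a)
  rw [h1, h2, hxz] at h3
  simp at h3

/-- Opposite edges of the rhombus on a pair of adjacent vertices and their common neighbours in a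
Shrikhande fibre have the same type. -/
theorem rhombus_parallel [Finite V] (hΓ : Γ.IsCommWDR)
    (hF : IsFibre shrikhandeGraph Γ.toSimpleGraphInclusive F) {s : ZMod 4 × ZMod 4}
    (hs : s ∈ hexagon) (a : ZMod 4 × ZMod 4) :
    Γ.twoWayDist (F a) (F (a + rot s)) = Γ.twoWayDist (F (a + rotInv s)) (F (a + s)) ∧
      Γ.twoWayDist (F (a + rot s)) (F (a + s)) = Γ.twoWayDist (F a) (F (a + rotInv s)) := by
  have e1 : a + rot s + rotInv s = a + s := by rw [add_assoc, rot_add_rotInv]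
  have e2 : a + rotInv s + rot s = a + s := by rw [add_right_comm, e1]
  have cn1 := commonNeighbors_edge hF hs a
  have cn2 := commonNeighbors_edge hF (rotInv_mem hs) (a + rot s)
  have cn3 := commonNeighbors_edge hF (rot_mem hs) (a + rotInv s)
  have cn4 := commonNeighbors_edge hF (rotInv_mem hs) a
  have cn5 := commonNeighbors_edge hF (rot_mem hs) a
  rw [rot_rotInv, rotInv_rotInv, add_neg_cancel_right, e1, Set.pair_comm] at cn2
  rw [rotInv_rot, rot_rot, add_neg_cancel_right, e2] at cn3
  rw [rot_rotInv, SimpleGraph.commonNeighbors_symm] at cn4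
  rw [rotInv_rot, SimpleGraph.commonNeighbors_symm, Set.pair_comm] at cn5
  rcases hΓ.quadrangle cn1 (commonNeighbors_rot hF hs a) with h | ⟨h1, h2, h3⟩
  · exact h
  have r0 := twoWayDist_swap Γ (F a) (F (a + rot s))
  have r1 := twoWayDist_swap Γ (F (a + rot s)) (F (a + s))
  have r2 := twoWayDist_swap Γ (F (a + s)) (F (a + rotInv s))
  have r3 := twoWayDist_swap Γ (F (a + rotInv s)) (F a)
  have hA := adj_fibre hF hs a
  have hA' := hΓ.underlying_adj.1 (adj_fibre hF (rot_mem hs) a)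
  generalize hi : Γ.twoWayDist (F a) (F (a + rot s)) = i at *
  rw [h1] at r1
  rw [h2] at r2
  rw [h3] at r3
  by_cases hsw : i = i.swap
  · rw [← r2, ← r3, h1, ← hsw]
    exact ⟨rfl, rfl⟩
  exfalso
  rcases hA' with h | h
  · obtain ⟨rfl, h4⟩ := hΓ.chord_type hi h1 h2 h3 h hsw cn2 cn4 hA
    exact hΓ.not_directed_rhombus hF (rot_mem hs) h4 hi h1 h2 h3
  · -- the same 4-cycle in the opposite direction
    obtain ⟨h5, h4⟩ := hΓ.chord_type r3.symm r2.symm r1.symm r0.symm h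
      (fun h => hsw (by simpa using h.symm)) cn3 cn5 hA
    exact hΓ.not_directed_rhombus hF (rotInv_mem hs) h4 (r3.symm.trans h5) (r2.symm.trans h5)
      (r1.symm.trans h5) (r0.symm.trans h5)

end Fibre

end Digraph.IsCommWDR

/-! ### Classification of Shrikhande fibres -/

namespace Shrikhande

/-- The connection set `{(1, 0), (0, 1), (-1, -1)}`, every other vertex of the hexagon. -/
def generators : Finset (ZMod 4 × ZMod 4) := {(1, 0), (0, 1), (-1, -1)}

theorem generators_subset : generators ⊆ hexagon := by decide

/-- A function on `ℤ₄ × ℤ₄` that is invariant under the translations by two elements at distance two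
in the hexagon is constant. -/
theorem eq_of_invariant {β : Type*} {f : ZMod 4 × ZMod 4 → β} {u : ZMod 4 × ZMod 4}
    (hu : u ∈ hexagon) (h1 : ∀ a, f (a + rot u) = f a) (h2 : ∀ a, f (a + rotInv u) = f a)
    (a b : ZMod 4 × ZMod 4) : f a = f b := by
  have key : ∀ u ∈ hexagon, ∀ g : ZMod 4 × ZMod 4, ∃ n m : Fin 4,
      g = (n : ℕ) • rot u + (m : ℕ) • rotInv u := by decide
  obtain ⟨n, m, hg⟩ := key u hu (a - b)
  have h3 : ∀ (n : ℕ) a, f (a + n • rot u) = f a := by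
    intro n
    induction n with
    | zero => simp
    | succ n ih => intro a; rw [succ_nsmul, ← add_assoc, h1, ih]
  have h4 : ∀ (n : ℕ) a, f (a + n • rotInv u) = f a := by
    intro n
    induction n with
    | zero => simp
    | succ n ih => intro a; rw [succ_nsmul, ← add_assoc, h2, ih]
  rw [← add_sub_cancel b a, hg, ← add_assoc, h4, h3]

/-- A set that contains exactly one of `s, -s` for each `s` in the hexagon and no three consecutive
elements consists of every other element of the hexagon. -/
theorem alternating {P : ZMod 4 × ZMod 4 → Prop}
    (h1 : ∀ s ∈ hexagon, (P (-s) ↔ ¬ P s))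
    (h2 : ∀ s ∈ hexagon, ¬ (P s ∧ P (rot s) ∧ P (rotInv s))) :
    (∀ s ∈ generators, P s) ∨ (∀ s ∈ generators, P (-s)) := by
  have a1 := h1 (1, 0) (by decide)
  have a2 := h1 (0, 1) (by decide)
  have a3 := h1 (-1, -1) (by decide)
  have a4 := h1 (1, 1) (by decide)
  have b1 := h2 (1, 0) (by decide)
  have b2 := h2 (0, 1) (by decide)
  have b3 := h2 (-1, -1) (by decide)
  have b4 := h2 (-1, 0) (by decide)
  have b5 := h2 (0, -1) (by decide)
  have b6 := h2 (1, 1) (by decide)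
  simp only [rot, rotInv, generators, Finset.mem_insert, Finset.mem_singleton, forall_eq_or_imp,
    forall_eq, Prod.neg_mk, neg_zero, neg_neg, sub_zero, zero_sub, sub_self, sub_neg_eq_add,
    zero_add] at *
  grind

end Shrikhande

namespace Digraph.IsCommWDR

open Shrikhande

variable {V : Type*} {Γ : Digraph V} {F : ZMod 4 × ZMod 4 → V}

/-- The type of the edge from `a` to `a + s` in a Shrikhande fibre does not depend on `a`. -/
theorem translation_invariant [Finite V] (hΓ : Γ.IsCommWDR)
    (hF : IsFibre shrikhandeGraph Γ.toSimpleGraphInclusive F) {s : ZMod 4 × ZMod 4}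
    (hs : s ∈ hexagon) (a b : ZMod 4 × ZMod 4) :
    Γ.twoWayDist (F a) (F (a + s)) = Γ.twoWayDist (F b) (F (b + s)) := by
  refine eq_of_invariant (f := fun a => Γ.twoWayDist (F a) (F (a + s))) hs ?_ ?_ a b
  · intro a
    have h := (hΓ.rhombus_parallel hF (rotInv_mem hs) (a + rot s)).1
    rw [rot_rotInv, rotInv_rotInv, add_neg_cancel_right] at h
    rw [h, add_assoc a, rot_add_rotInv]
  · intro a
    have h := (hΓ.rhombus_parallel hF (rot_mem hs) (a + rotInv s)).2
    rw [rotInv_rot, rot_rot, add_neg_cancel_right] at h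
    rw [← h, add_assoc a, add_comm (rotInv s), rot_add_rotInv]

theorem type_neg [Finite V] (hΓ : Γ.IsCommWDR)
    (hF : IsFibre shrikhandeGraph Γ.toSimpleGraphInclusive F) {s : ZMod 4 × ZMod 4}
    (hs : s ∈ hexagon) (a b : ZMod 4 × ZMod 4) :
    Γ.twoWayDist (F a) (F (a - s)) = (Γ.twoWayDist (F b) (F (b + s))).swap := by
  rw [hΓ.translation_invariant hF hs b (a - s), sub_add_cancel, twoWayDist_swap]

theorem type_double [Finite V] (hΓ : Γ.IsCommWDR)
    (hF : IsFibre shrikhandeGraph Γ.toSimpleGraphInclusive F) {s : ZMod 4 × ZMod 4}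
    (hs : s ∈ hexagon) (a : ZMod 4 × ZMod 4) :
    Γ.twoWayDist (F a) (F (a + s + s)) = (2, 2) := by
  have hnadj : ¬ Γ.toSimpleGraphInclusive.Adj (F a) (F (a + s + s)) := by
    rw [hF.adj_iff, add_assoc, adj_add_iff]
    revert s; decide
  have hne : F a ≠ F (a + s + s) := by
    rw [hF.injective.ne_iff, add_assoc]
    simpa using double_ne_zero hs
  rw [hΓ.underlying_adj, hΓ.fst_eq_one, hΓ.snd_eq_one, not_or] at hnadj
  have h4 : a + s + s + s + s = a := by
    have : s + s + s + s = 0 := by clear hnadj hne; revert s; decide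
    rw [show a + s + s + s + s = a + (s + s + s + s) by abel, this, add_zero]
  have h5 : a + s + s + s = a - s := by rw [eq_sub_iff_add_eq, h4]
  -- one of `s, -s` is an arc of the fibre, and `2s = -2s`
  suffices h : (∃ z, Γ.Adj (F a) z ∧ Γ.Adj z (F (a + s + s))) ∧
      ∃ z, Γ.Adj (F (a + s + s)) z ∧ Γ.Adj z (F a) by
    obtain ⟨⟨z, h1, h2⟩, w, h3, h4⟩ := h
    exact Prod.ext (hΓ.wdr.1.dist_eq_two hΓ.loopless h1 h2 hne hnadj.1)
      (hΓ.wdr.1.dist_eq_two hΓ.loopless h3 h4 hne.symm hnadj.2)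
  have inv := fun b => hΓ.translation_invariant hF hs b a
  rcases hΓ.underlying_adj.1 (adj_fibre hF hs a) with h | h
  · have adj : ∀ b, Γ.Adj (F b) (F (b + s)) := fun b => hΓ.fst_eq_one.1 (by rw [inv, h])
    refine ⟨⟨F (a + s), adj _, adj _⟩, F (a + s + s + s), adj _, ?_⟩
    have := adj (a + s + s + s)
    rwa [h4] at this
  · have adj : ∀ b, Γ.Adj (F (b + s)) (F b) := fun b => hΓ.snd_eq_one.1 (by rw [inv, h])
    refine ⟨⟨F (a + s + s + s), ?_, adj _⟩, F (a + s), adj _, adj _⟩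
    have := adj (a + s + s + s)
    rwa [h4] at this

/-- The pairs `a, a + 2s` have the same two-way distance for all `s`; comparing the paths of length
two between them, an edge type at `a` occurs in every direction. -/
theorem type_eq_or_neg [Finite V] (hΓ : Γ.IsCommWDR)
    (hF : IsFibre shrikhandeGraph Γ.toSimpleGraphInclusive F) {s u : ZMod 4 × ZMod 4}
    (hs : s ∈ hexagon) (hu : u ∈ hexagon) (a : ZMod 4 × ZMod 4) :
    Γ.twoWayDist (F a) (F (a + u)) = Γ.twoWayDist (F a) (F (a + s)) ∨
      Γ.twoWayDist (F a) (F (a - u)) = Γ.twoWayDist (F a) (F (a + s)) := by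
  have hm : F (a + s) ∈ Γ.toSimpleGraphInclusive.commonNeighbors (F a) (F (a + s + s)) := by
    rw [commonNeighbors_double hF hs]; simp
  have h := hΓ.exists_transfer_mem hm
    ((hΓ.type_double hF hu a).trans (hΓ.type_double hF hs a).symm) (commonNeighbors_double hF hu a)
  exact h.imp And.left And.left

/-- The possible types of a Shrikhande fibre: all edges are undirected, or the arcs form
a Cayley digraph with connection set `generators` or `-generators` and are of type `(1, 2)`. -/
theorem fibre_types [Finite V] (hΓ : Γ.IsCommWDR)
    (hF : IsFibre shrikhandeGraph Γ.toSimpleGraphInclusive F) :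
    (∀ a, ∀ s ∈ hexagon, Γ.twoWayDist (F a) (F (a + s)) = (1, 1)) ∨
      (∀ a, ∀ s ∈ generators, Γ.twoWayDist (F a) (F (a + s)) = (1, 2)) ∨
      (∀ a, ∀ s ∈ generators, Γ.twoWayDist (F a) (F (a - s)) = (1, 2)) := by
  by_cases hsym : ∃ s ∈ hexagon, Γ.twoWayDist (F 0) (F (0 + s)) = (1, 1)
  · left
    intro a u hu
    obtain ⟨s, hs, h⟩ := hsym
    rw [hΓ.translation_invariant hF hu a 0]
    rcases hΓ.type_eq_or_neg hF hs hu 0 with h1 | h1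
    · rw [h1, h]
    · rw [h, hΓ.type_neg hF hu 0 0, Prod.swap_eq_iff_eq_swap] at h1
      exact h1
  right
  -- `P s` says that the edges in direction `s` are arcs
  let P : ZMod 4 × ZMod 4 → Prop := fun s => (Γ.twoWayDist (F 0) (F (0 + s))).1 = 1
  have hneg : ∀ s ∈ hexagon, Γ.twoWayDist (F 0) (F (0 + -s)) =
      (Γ.twoWayDist (F 0) (F (0 + s))).swap := by
    intro s hs
    rw [← sub_eq_add_neg]
    exact hΓ.type_neg hF hs 0 0
  have hne : ∀ s ∈ hexagon, P s → (Γ.twoWayDist (F 0) (F (0 + s))).2 ≠ 1 :=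
    fun s hs h1 h2 => hsym ⟨s, hs, Prod.ext h1 h2⟩
  have hP1 : ∀ s ∈ hexagon, (P (-s) ↔ ¬ P s) := by
    intro s hs
    change (Γ.twoWayDist (F 0) (F (0 + -s))).1 = 1 ↔ ¬ P s
    rw [hneg s hs, Prod.fst_swap]
    constructor
    · intro h1 h2
      exact hne s hs h2 h1
    · intro h
      exact (hΓ.underlying_adj.1 (adj_fibre hF hs 0)).resolve_left h
  have hP3 : ∀ s ∈ hexagon, ∀ u ∈ hexagon, P s → P u →
      Γ.twoWayDist (F 0) (F (0 + u)) = Γ.twoWayDist (F 0) (F (0 + s)) := by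
    intro s hs u hu h1 h2
    rcases hΓ.type_eq_or_neg hF hs hu 0 with h | h
    · exact h
    · rw [sub_eq_add_neg] at h
      have h3 : P (-u) := by change (Γ.twoWayDist (F 0) (F (0 + -u))).1 = 1; rwa [h]
      exact absurd h2 ((hP1 u hu).1 h3)
  have hP2 : ∀ s ∈ hexagon, ¬ (P s ∧ P (rot s) ∧ P (rotInv s)) := by
    rintro s hs ⟨h0, h1, h2⟩
    -- there is a path of constant type between the ends of an arc in direction `s`, but not `rot s`
    have hm : F (0 + rot s) ∈ Γ.toSimpleGraphInclusive.commonNeighbors (F 0) (F (0 + s)) := by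
      rw [commonNeighbors_edge hF hs]; simp
    have h := hΓ.exists_transfer_mem hm (hP3 _ hs _ (rot_mem hs) h0 h1)
      (commonNeighbors_edge hF (rot_mem hs) 0)
    have e1 : 0 + s = 0 + rot s + rotInv s := by rw [add_assoc, rot_add_rotInv]
    have e2 : 0 + rot s = 0 + s - rotInv s := by rw [eq_sub_iff_add_eq, e1]
    rw [e1, hΓ.translation_invariant hF (rotInv_mem hs) (0 + rot s) 0, rotInv_rot, rot_rot,
      hneg _ (rotInv_mem hs)] at h
    have h3 := hne _ (rotInv_mem hs) h2
    have h4 : (Γ.twoWayDist (F (0 + s)) (F (0 + rot s))).1 ≠ 1 := by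
      rw [e2, hΓ.type_neg hF (rotInv_mem hs) _ 0, Prod.fst_swap]
      exact h3
    rcases h with ⟨h, -⟩ | ⟨-, h⟩
    · apply h3
      rw [← Prod.fst_swap, h]
      exact h1
    · apply h4
      rw [h]
      exact h2
  have main : ∀ s ∈ hexagon, ∀ u ∈ hexagon, ∀ u' ∈ hexagon, P s → P u → P u' → s + u + u' = 0 →
      ∀ a, Γ.twoWayDist (F a) (F (a + s)) = (1, 2) := by
    intro s hs u hu u' hu' h1 h2 h3 h0 a
    have adj : ∀ b, ∀ u ∈ hexagon, P u → Γ.Adj (F b) (F (b + u)) := fun b u hu h =>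
      hΓ.fst_eq_one.1 (by rw [hΓ.translation_invariant hF hu b 0]; exact h)
    have hback := adj (a + s + u) u' hu' h3
    rw [show a + s + u + u' = a + (s + u + u') by abel, h0, add_zero] at hback
    have hs' := hne s hs h1
    rw [hΓ.translation_invariant hF hs 0 a, Ne, hΓ.snd_eq_one] at hs'
    refine Prod.ext (hΓ.fst_eq_one.2 (adj a s hs h1))
      (hΓ.wdr.1.dist_eq_two hΓ.loopless (adj (a + s) u hu h2) hback ?_ hs')
    exact (adj_fibre hF hs a).ne'
  have htri : ∀ s ∈ generators, ∃ u ∈ generators, ∃ u' ∈ generators, s + u + u' = 0 := by decide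
  refine (alternating hP1 hP2).imp (fun h a s hs => ?_) (fun h a s hs => ?_) <;>
    obtain ⟨u, hu, u', hu', h0⟩ := htri s hs
  · exact main s (generators_subset hs) u (generators_subset hu) u' (generators_subset hu')
      (h s hs) (h u hu) (h u' hu') h0 a
  · rw [sub_eq_add_neg]
    exact main (-s) (neg_mem (generators_subset hs)) (-u) (neg_mem (generators_subset hu)) (-u')
      (neg_mem (generators_subset hu')) (h s hs) (h u hu) (h u' hu')
      (by rw [← neg_add, ← neg_add, h0, neg_zero]) a

end Digraph.IsCommWDR

namespace Digraph.IsCommWDR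

open Shrikhande

/-! ### Complete fibres, and undirected Shrikhande fibres -/

variable {V : Type*} {Γ : Digraph V}

theorem commonNeighbors_complete {K : Fin 4 → V}
    (hK : IsFibre (⊤ : SimpleGraph (Fin 4)) Γ.toSimpleGraphInclusive K) {a b c d : Fin 4}
    (h : [a, b, c, d].Nodup) :
    Γ.toSimpleGraphInclusive.commonNeighbors (K a) (K b) = {K c, K d} := by
  have hab : a ≠ b := by rintro rfl; simp at h
  rw [hK.commonNeighbors hab, ← Set.image_pair]
  congr 1
  ext z
  rw [SimpleGraph.mem_commonNeighbors, SimpleGraph.top_adj, SimpleGraph.top_adj]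
  change _ ↔ z = c ∨ z = d
  revert a b c d z
  decide

/-- Commutativity excludes that a complete fibre is a tournament. -/
theorem exists_undirected_of_complete [Finite V] (hΓ : Γ.IsCommWDR) {K : Fin 4 → V}
    (hK : IsFibre (⊤ : SimpleGraph (Fin 4)) Γ.toSimpleGraphInclusive K) :
    ∃ a b, a ≠ b ∧ Γ.twoWayDist (K a) (K b) = (1, 1) := by
  by_contra! hcon
  have hneg : ∀ a b, a ≠ b → (Γ.Adj (K b) (K a) ↔ ¬ Γ.Adj (K a) (K b)) := by
    intro a b hab
    have h1 := (hK.adj_iff a b).2 hab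
    rw [hΓ.underlying_adj, hΓ.fst_eq_one, hΓ.snd_eq_one] at h1
    have h2 : ¬ (Γ.Adj (K a) (K b) ∧ Γ.Adj (K b) (K a)) := fun h =>
      hcon a b hab (Prod.ext (hΓ.fst_eq_one.2 h.1) (hΓ.snd_eq_one.2 h.2))
    tauto
  have hpath : ∀ a b c d : Fin 4, [a, b, c, d].Nodup →
      (Γ.Adj (K a) (K c) ↔ Γ.Adj (K d) (K b)) ∧ (Γ.Adj (K c) (K b) ↔ Γ.Adj (K a) (K d)) ∨
      (Γ.Adj (K a) (K c) ↔ Γ.Adj (K c) (K b)) ∧ (Γ.Adj (K a) (K d) ↔ Γ.Adj (K d) (K b)) := by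
    intro a b c d h
    simp only [← hΓ.fst_eq_one]
    refine (hΓ.path_types (commonNeighbors_complete hK h)).imp ?_ ?_ <;>
      · rintro ⟨h1, h2⟩
        rw [h1, h2]
        exact ⟨Iff.rfl, Iff.rfl⟩
  have n01 := hneg 0 1 (by decide)
  have n02 := hneg 0 2 (by decide)
  have n03 := hneg 0 3 (by decide)
  have n12 := hneg 1 2 (by decide)
  have n13 := hneg 1 3 (by decide)
  have n23 := hneg 2 3 (by decide)
  have p01 := hpath 0 1 2 3 (by decide)
  have p02 := hpath 0 2 1 3 (by decide)
  have p03 := hpath 0 3 1 2 (by decide)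
  have p12 := hpath 1 2 0 3 (by decide)
  have p13 := hpath 1 3 0 2 (by decide)
  have p23 := hpath 2 3 0 1 (by decide)
  simp only [n01, n02, n03, n12, n13, n23] at *
  clear hneg hpath hcon n01 n02 n03 n12 n13 n23
  generalize Γ.Adj (K 0) (K 1) = q01 at *
  generalize Γ.Adj (K 0) (K 2) = q02 at *
  generalize Γ.Adj (K 0) (K 3) = q03 at *
  generalize Γ.Adj (K 1) (K 2) = q12 at *
  generalize Γ.Adj (K 1) (K 3) = q13 at *
  generalize Γ.Adj (K 2) (K 3) = q23 at *
  clear hK hΓ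
  grind

variable {F : ZMod 4 × ZMod 4 → V}

/-- If some Shrikhande fibre is undirected, then so is every other one, because of the pairs at
two-way distance `(2, 2)`. -/
theorem undirected_shrikhande [Finite V] (hΓ : Γ.IsCommWDR)
    (hF : IsFibre shrikhandeGraph Γ.toSimpleGraphInclusive F)
    (h11 : ∀ a, ∀ s ∈ hexagon, Γ.twoWayDist (F a) (F (a + s)) = (1, 1))
    {F' : ZMod 4 × ZMod 4 → V} (hF' : IsFibre shrikhandeGraph Γ.toSimpleGraphInclusive F')
    (a : ZMod 4 × ZMod 4) {s : ZMod 4 × ZMod 4} (hs : s ∈ hexagon) :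
    Γ.twoWayDist (F' a) (F' (a + s)) = (1, 1) := by
  have hm : F (0 + s) ∈ Γ.toSimpleGraphInclusive.commonNeighbors (F 0) (F (0 + s + s)) := by
    rw [commonNeighbors_double hF hs]; simp
  have h := hΓ.exists_transfer_mem hm
    ((hΓ.type_double hF' hs a).trans (hΓ.type_double hF hs 0).symm)
    (commonNeighbors_double hF' hs a)
  rw [h11 0 s hs, h11 (0 + s) s hs] at h
  rcases h with h | h
  · exact h.1
  · have h1 := h.1
    rw [hΓ.type_neg hF' hs a a, Prod.swap_eq_iff_eq_swap] at h1
    exact h1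

/-- If some Shrikhande fibre is undirected, then both common neighbours of the ends of an undirected
edge are joined to them by undirected edges, so that an undirected edge of a complete fibre makes
this fibre undirected. -/
theorem undirected_complete [Finite V] (hΓ : Γ.IsCommWDR)
    (hF : IsFibre shrikhandeGraph Γ.toSimpleGraphInclusive F)
    (h11 : ∀ a, ∀ s ∈ hexagon, Γ.twoWayDist (F a) (F (a + s)) = (1, 1))
    {K : Fin 4 → V} (hK : IsFibre ⊤ Γ.toSimpleGraphInclusive K) {a b : Fin 4} (hab : a ≠ b) :
    Γ.twoWayDist (K a) (K b) = (1, 1) := by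
  have hs : ((1, 0) : ZMod 4 × ZMod 4) ∈ hexagon := by decide
  have step : ∀ a b c d : Fin 4, [a, b, c, d].Nodup → Γ.twoWayDist (K a) (K b) = (1, 1) →
      Γ.twoWayDist (K a) (K c) = (1, 1) := by
    intro a b c d hnd hab
    have hne : F (0 + rot (1, 0)) ≠ F (0 + rotInv (1, 0)) := by
      rw [hF.injective.ne_iff]; decide
    have e1 : (0 : ZMod 4 × ZMod 4) + (1, 0) = 0 + rot (1, 0) + rotInv (1, 0) := by decide
    have e2 : (0 : ZMod 4 × ZMod 4) + (1, 0) = 0 + rotInv (1, 0) + rot (1, 0) := by decide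
    obtain ⟨z, w, hzw, ⟨hz1, hz2⟩, ⟨hw1, hw2⟩⟩ := hΓ.exists_transfer_two hne
      (h11 0 _ (rot_mem hs)) (e1 ▸ h11 (0 + rot (1, 0)) _ (rotInv_mem hs))
      (h11 0 _ (rotInv_mem hs)) (e2 ▸ h11 (0 + rotInv (1, 0)) _ (rot_mem hs))
      (hab.trans (h11 0 _ hs).symm)
    have mem : ∀ z, Γ.twoWayDist (K a) z = (1, 1) → Γ.twoWayDist z (K b) = (1, 1) →
        z = K c ∨ z = K d := by
      intro z hz1 hz2
      have h := hΓ.mem_commonNeighbors (adj_fibre hF hs 0) (adj_fibre hF hs 0)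
        (hz1.trans (h11 0 _ hs).symm) (hz2.trans (h11 0 _ hs).symm)
      rwa [commonNeighbors_complete hK hnd] at h
    rcases mem z hz1 hz2 with rfl | rfl
    · exact hz1
    · rcases mem w hw1 hw2 with rfl | rfl
      · exact hw1
      · exact absurd rfl hzw
  have symm : ∀ a b, Γ.twoWayDist (K a) (K b) = (1, 1) → Γ.twoWayDist (K b) (K a) = (1, 1) := by
    intro a b h
    rw [← twoWayDist_swap, h]; rfl
  -- the undirected edges at a vertex are all or none
  have step' : ∀ a b c : Fin 4, a ≠ b → a ≠ c → Γ.twoWayDist (K a) (K b) = (1, 1) →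
      Γ.twoWayDist (K a) (K c) = (1, 1) := by
    intro a b c h1 h2 h
    by_cases h3 : b = c
    · rwa [← h3]
    · obtain ⟨d, hd⟩ : ∃ d, [a, b, c, d].Nodup := by clear step symm h; revert a b c; decide
      exact step a b c d hd h
  obtain ⟨c, d, hcd, h⟩ := hΓ.exists_undirected_of_complete hK
  by_cases hac : a = c
  · subst hac
    exact step' a d b hcd hab h
  · exact step' a c b hac hab (symm _ _ (step' c d a hcd (Ne.symm hac) h))

theorem symm_of_undirected_fibre [Finite V] (hΓ : Γ.IsCommWDR)
    (hcov : Γ.toSimpleGraphInclusive.HasDoobFibres)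
    (hF : IsFibre shrikhandeGraph Γ.toSimpleGraphInclusive F)
    (h11 : ∀ a, ∀ s ∈ hexagon, Γ.twoWayDist (F a) (F (a + s)) = (1, 1)) {x y : V}
    (hxy : Γ.Adj x y) : Γ.Adj y x := by
  have hadj : Γ.toSimpleGraphInclusive.Adj x y := by
    rw [hΓ.underlying_adj, hΓ.fst_eq_one]; exact Or.inl hxy
  rw [← hΓ.snd_eq_one]
  rcases hcov x y hadj with ⟨F', hF', ⟨a, rfl⟩, b, rfl⟩ | ⟨K, hK, ⟨a, rfl⟩, b, rfl⟩
  · rw [hF'.adj_iff, adj_iff] at hadj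
    have := hΓ.undirected_shrikhande hF h11 hF' a hadj
    rw [add_sub_cancel] at this
    rw [this]
  · rw [hΓ.undirected_complete hF h11 hK ((hK.adj_iff a b).1 hadj)]

end Digraph.IsCommWDR

/-! ### Cartesian products of digraphs -/

namespace Digraph

section BoxProd

variable {A W V : Type*} {C : Digraph A} {D : Digraph W} {Γ : Digraph V} {e : A × W ≃ V}

theorem HasPathOfLength.trans {Γ : Digraph V} {m n : ℕ} {x y z : V}
    (h : Γ.HasPathOfLength m x y) (h' : Γ.HasPathOfLength n y z) :
    Γ.HasPathOfLength (m + n) x z := by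
  induction m generalizing x with
  | zero =>
    obtain rfl : x = y := h
    rwa [Nat.zero_add]
  | succ m ih =>
    obtain ⟨w, hw, h⟩ := h
    rw [Nat.add_right_comm]
    exact ⟨w, hw, ih h⟩

/-- `e` identifies `Γ` with the Cartesian product of the digraphs `C` and `D`. -/
def IsBoxProd (C : Digraph A) (D : Digraph W) (Γ : Digraph V) (e : A × W ≃ V) : Prop :=
  ∀ a w a' w', Γ.Adj (e (a, w)) (e (a', w')) ↔ (C.Adj a a' ∧ w = w') ∨ (D.Adj w w' ∧ a = a')

theorem IsBoxProd.hasPath_iff (h : IsBoxProd C D Γ e) {r : ℕ} {a a' : A} {w w' : W} :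
    Γ.HasPathOfLength r (e (a, w)) (e (a', w')) ↔
      ∃ m n, r = m + n ∧ C.HasPathOfLength m a a' ∧ D.HasPathOfLength n w w' := by
  constructor
  · induction r generalizing a w with
    | zero =>
      intro h0
      have h0 : e (a, w) = e (a', w') := h0
      rw [e.apply_eq_iff_eq, Prod.mk.injEq] at h0
      exact ⟨0, 0, rfl, h0.1, h0.2⟩
    | succ r ih =>
      rintro ⟨z, hz, hr⟩
      obtain ⟨⟨b, v⟩, rfl⟩ := e.surjective z
      obtain ⟨m, n, rfl, hm, hn⟩ := ih hr
      rcases (h _ _ _ _).1 hz with ⟨h1, rfl⟩ | ⟨h1, rfl⟩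
      · exact ⟨m + 1, n, by omega, ⟨b, h1, hm⟩, hn⟩
      · exact ⟨m, n + 1, by omega, hm, ⟨v, h1, hn⟩⟩
  · rintro ⟨m, n, rfl, hm, hn⟩
    refine HasPathOfLength.trans (y := e (a', w)) ?_ ?_
    · clear hn
      induction m generalizing a with
      | zero => exact congrArg (fun a => e (a, w)) hm
      | succ m ih =>
        obtain ⟨b, hb, hm⟩ := hm
        exact ⟨e (b, w), (h _ _ _ _).2 (Or.inl ⟨hb, rfl⟩), ih hm⟩
    · clear hm
      induction n generalizing w with
      | zero => exact congrArg (fun w => e (a', w)) hn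
      | succ n ih =>
        obtain ⟨b, hb, hn⟩ := hn
        exact ⟨e (a', b), (h _ _ _ _).2 (Or.inr ⟨hb, rfl⟩), ih hn⟩

theorem IsBoxProd.stronglyConnected_left [Nonempty W] (h : IsBoxProd C D Γ e)
    (hs : Γ.StronglyConnected) : C.StronglyConnected := by
  intro a a'
  obtain ⟨w⟩ := ‹Nonempty W›
  obtain ⟨r, hr⟩ := hs (e (a, w)) (e (a', w))
  obtain ⟨m, n, -, hm, -⟩ := h.hasPath_iff.1 hr
  exact ⟨m, hm⟩

theorem IsBoxProd.stronglyConnected_right [Nonempty A] (h : IsBoxProd C D Γ e)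
    (hs : Γ.StronglyConnected) : D.StronglyConnected := by
  intro w w'
  obtain ⟨a⟩ := ‹Nonempty A›
  obtain ⟨r, hr⟩ := hs (e (a, w)) (e (a, w'))
  obtain ⟨m, n, -, -, hn⟩ := h.hasPath_iff.1 hr
  exact ⟨n, hn⟩

theorem IsBoxProd.dist_eq (h : IsBoxProd C D Γ e) (hs : Γ.StronglyConnected) (a a' : A)
    (w w' : W) : Γ.dist (e (a, w)) (e (a', w')) = C.dist a a' + D.dist w w' := by
  have : Nonempty A := ⟨a⟩
  have : Nonempty W := ⟨w⟩
  have hC := h.stronglyConnected_left hs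
  have hD := h.stronglyConnected_right hs
  apply le_antisymm
  · exact dist_le_of_hasPath (h.hasPath_iff.2 ⟨_, _, rfl, hC.hasPath_dist _ _, hD.hasPath_dist _ _⟩)
  · obtain ⟨m, n, hr, hm, hn⟩ := h.hasPath_iff.1 (hs.hasPath_dist (e (a, w)) (e (a', w')))
    rw [hr]
    exact add_le_add (dist_le_of_hasPath hm) (dist_le_of_hasPath hn)

end BoxProd

end Digraph

namespace Shrikhande

/-- The sums of `n` elements of `generators`. -/
def sums : ℕ → Finset (ZMod 4 × ZMod 4)
  | 0 => {0}
  | n + 1 => Finset.image₂ (· + ·) generators (sums n)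

/-- The least number of elements of `generators` with sum `g`. -/
def length (g : ZMod 4 × ZMod 4) : ℕ :=
  if g = 0 then 0 else if g ∈ generators then 1 else if -g ∈ generators ∨ -g = g then 2 else 3

theorem hasPath_cayley_iff {n : ℕ} {a b : ZMod 4 × ZMod 4} :
    (Digraph.addCayley (generators : Set (ZMod 4 × ZMod 4))).HasPathOfLength n a b ↔
      b - a ∈ sums n := by
  induction n generalizing a with
  | zero => simp [Digraph.HasPathOfLength, sums, sub_eq_zero, eq_comm]
  | succ n ih =>
    rw [sums, Finset.mem_image₂]
    constructor
    · rintro ⟨z, hz, h⟩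
      exact ⟨-a + z, hz, b - z, ih.1 h, by abel⟩
    · rintro ⟨s, hs, t, ht, h⟩
      refine ⟨a + s, ?_, ih.2 ?_⟩
      · change -a + (a + s) ∈ (generators : Set _)
        rwa [neg_add_cancel_left]
      · rwa [← sub_sub, ← h, add_sub_cancel_left]

theorem dist_cayley (a b : ZMod 4 × ZMod 4) :
    (Digraph.addCayley (generators : Set (ZMod 4 × ZMod 4))).dist a b = length (b - a) := by
  have h1 : ∀ g, g ∈ sums (length g) := by decide
  have h2 : ∀ g, ∀ j < length g, g ∉ sums j := by decide
  have hpath := hasPath_cayley_iff.2 (h1 (b - a))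
  apply le_antisymm (Digraph.dist_le_of_hasPath hpath)
  by_contra hlt
  have hmem := Nat.sInf_mem (s := {r | (Digraph.addCayley
    (generators : Set (ZMod 4 × ZMod 4))).HasPathOfLength r a b}) ⟨_, hpath⟩
  exact h2 _ _ (not_le.1 hlt) (hasPath_cayley_iff.1 hmem)

end Shrikhande

namespace Digraph.IsCommWDR

open Shrikhande

/-! ### A directed Shrikhande fibre is a Cartesian factor -/

section Product

variable {V W : Type*} {Γ : Digraph V} {K : SimpleGraph W}

theorem commonNeighbors_cross {A : Type*} {G : SimpleGraph A} {H : SimpleGraph V}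
    (e : G.boxProd K ≃g H) {a a' : A} {w w' : W} (ha : G.Adj a a') (hw : K.Adj w w') :
    H.commonNeighbors (e (a, w)) (e (a', w')) = {e (a', w), e (a, w')} := by
  ext z
  obtain ⟨⟨b, v⟩, rfl⟩ := e.surjective z
  rw [SimpleGraph.mem_commonNeighbors, e.map_adj_iff, e.map_adj_iff, Set.mem_insert_iff,
    Set.mem_singleton_iff, e.injective.eq_iff, e.injective.eq_iff, SimpleGraph.boxProd_adj,
    SimpleGraph.boxProd_adj, Prod.mk.injEq, Prod.mk.injEq]
  constructor
  · rintro ⟨⟨h1, rfl⟩ | ⟨h1, rfl⟩, ⟨h2, h3⟩ | ⟨h2, rfl⟩⟩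
    · exact absurd h3.symm hw.ne
    · exact Or.inl ⟨rfl, rfl⟩
    · exact Or.inr ⟨rfl, h3.symm⟩
    · exact absurd rfl ha.ne
  · rintro (⟨rfl, rfl⟩ | ⟨rfl, rfl⟩)
    · exact ⟨Or.inl ⟨ha, rfl⟩, Or.inr ⟨hw.symm, rfl⟩⟩
    · exact ⟨Or.inr ⟨hw, rfl⟩, Or.inl ⟨ha.symm, rfl⟩⟩

/-- In a square with one side in a Shrikhande fibre, opposite edges have the same type: directed
4-cycles are excluded because two consecutive squares along the fibre would both have to be
directed 4-cycles. -/
theorem cross_parallel [Finite V] (hΓ : Γ.IsCommWDR)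
    (e : shrikhandeGraph.boxProd K ≃g Γ.toSimpleGraphInclusive) {s : ZMod 4 × ZMod 4}
    (hs : s ∈ hexagon) (a : ZMod 4 × ZMod 4) {w w' : W} (hw : K.Adj w w') :
    Γ.twoWayDist (e (a, w)) (e (a + s, w)) = Γ.twoWayDist (e (a, w')) (e (a + s, w')) ∧
      Γ.twoWayDist (e (a + s, w)) (e (a + s, w')) = Γ.twoWayDist (e (a, w)) (e (a, w')) := by
  have quad : ∀ a, _ := fun a => hΓ.quadrangle
    (commonNeighbors_cross e (adj_add_iff.2 hs : shrikhandeGraph.Adj a (a + s)) hw)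
    (commonNeighbors_cross e (adj_add_iff.2 hs : shrikhandeGraph.Adj a (a + s)).symm hw)
  rcases quad a with h | ⟨h1, h2, h3⟩
  · exact h
  have i1 := hΓ.translation_invariant (isFibre_of_boxProd_iso e w) hs (a + s) a
  have i2 := hΓ.translation_invariant (isFibre_of_boxProd_iso e w') hs (a + s) a
  rcases quad (a + s) with ⟨h4, h5⟩ | ⟨h4, h5, h6⟩ <;>
    · simp only [twoWayDist, Prod.mk.injEq] at *
      omega

/-- If the Shrikhande fibre through one vertex is a Cayley digraph with connection set
`generators`, then this Cayley digraph is a Cartesian factor of `Γ`. -/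
theorem isBoxProd [Finite V] (hΓ : Γ.IsCommWDR)
    (e : shrikhandeGraph.boxProd K ≃g Γ.toSimpleGraphInclusive) {w₀ : W}
    (h₀ : ∀ a, ∀ s ∈ generators, Γ.twoWayDist (e (a, w₀)) (e (a + s, w₀)) = (1, 2)) :
    ∃ D : Digraph W,
      IsBoxProd (addCayley (generators : Set (ZMod 4 × ZMod 4))) D Γ e.toEquiv := by
  have hall : ∀ w, ∀ a, ∀ s ∈ generators,
      Γ.twoWayDist (e (a, w)) (e (a + s, w)) = (1, 2) := by
    have hpath : ∀ r, ∀ p q : (ZMod 4 × ZMod 4) × W, Γ.HasPathOfLength r (e p) (e q) →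
        (∀ a, ∀ s ∈ generators, Γ.twoWayDist (e (a, p.2)) (e (a + s, p.2)) = (1, 2)) →
        ∀ a, ∀ s ∈ generators, Γ.twoWayDist (e (a, q.2)) (e (a + s, q.2)) = (1, 2) := by
      intro r
      induction r with
      | zero =>
        intro p q h
        have h : e p = e q := h
        rw [e.injective h]
        exact id
      | succ r ih =>
        rintro p q ⟨z, hz, hr⟩ hp
        obtain ⟨v, rfl⟩ := e.surjective z
        refine ih v q hr ?_
        have hadj : Γ.toSimpleGraphInclusive.Adj (e p) (e v) := by
          rw [hΓ.underlying_adj, hΓ.fst_eq_one]; exact Or.inl hz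
        rw [e.map_adj_iff, SimpleGraph.boxProd_adj] at hadj
        rcases hadj with ⟨-, h⟩ | ⟨h, -⟩
        · rwa [← h]
        · intro a s hs
          rw [← (hΓ.cross_parallel e (generators_subset hs) a h).1]
          exact hp a s hs
    intro w
    obtain ⟨r, hr⟩ := hΓ.wdr.1 (e (0, w₀)) (e (0, w))
    exact hpath r _ _ hr h₀
  have hcross : ∀ w w', K.Adj w w' → ∀ a b, Γ.twoWayDist (e (a, w)) (e (a, w')) =
      Γ.twoWayDist (e (b, w)) (e (b, w')) := by
    intro w w' hw a b
    have hs : ((1, 0) : ZMod 4 × ZMod 4) ∈ hexagon := by decide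
    exact eq_of_invariant (f := fun a => Γ.twoWayDist (e (a, w)) (e (a, w'))) hs
      (fun a => (hΓ.cross_parallel e (rot_mem hs) a hw).2)
      (fun a => (hΓ.cross_parallel e (rotInv_mem hs) a hw).2) a b
  have hK : ∀ a w w', Γ.toSimpleGraphInclusive.Adj (e (a, w)) (e (a, w')) ↔ K.Adj w w' := by
    intro a w w'
    rw [e.map_adj_iff, SimpleGraph.boxProd_adj_right]
  refine ⟨⟨fun w w' => Γ.Adj (e (0, w)) (e (0, w'))⟩, ?_⟩
  · intro a w a' w'
    change Γ.Adj (e (a, w)) (e (a', w')) ↔ (-a + a' ∈ (generators : Set _) ∧ w = w') ∨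
      (Γ.Adj (e (0, w)) (e (0, w')) ∧ a = a')
    have hvert : Γ.Adj (e (0, w)) (e (0, w')) ↔ Γ.Adj (e (a, w)) (e (a, w')) := by
      by_cases hw : K.Adj w w'
      · rw [← hΓ.fst_eq_one, hcross w w' hw 0 a, hΓ.fst_eq_one]
      · have h1 := mt (hK 0 w w').1 hw
        have h2 := mt (hK a w w').1 hw
        rw [hΓ.underlying_adj, hΓ.fst_eq_one] at h1 h2
        tauto
    rw [Finset.mem_coe, neg_add_eq_sub]
    constructor
    · intro h
      have hadj : Γ.toSimpleGraphInclusive.Adj (e (a, w)) (e (a', w')) := by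
        rw [hΓ.underlying_adj, hΓ.fst_eq_one]; exact Or.inl h
      rw [e.map_adj_iff, SimpleGraph.boxProd_adj] at hadj
      rcases hadj with ⟨h1, h2⟩ | ⟨-, h2⟩
      · obtain rfl : w = w' := h2
        refine Or.inl ⟨?_, rfl⟩
        rw [adj_iff] at h1
        by_contra hng
        have hneg : ∀ s ∈ hexagon, s ∉ generators → -s ∈ generators := by decide
        have h3 := hall w a' _ (hneg _ h1 hng)
        change (a' - a : ZMod 4 × ZMod 4) ∈ hexagon at h1
        rw [neg_sub, add_sub_cancel] at h3
        have h4 := hΓ.snd_eq_one.2 h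
        rw [h3] at h4
        simp at h4
      · obtain rfl : a = a' := h2
        exact Or.inr ⟨hvert.2 h, rfl⟩
    · rintro (⟨h1, rfl⟩ | ⟨h1, rfl⟩)
      · have := hall w a _ h1
        rw [add_sub_cancel] at this
        exact hΓ.fst_eq_one.1 (by rw [this])
      · exact hvert.1 h1

end Product

end Digraph.IsCommWDR

namespace Digraph.IsCommWDR

open Shrikhande

/-! ### A directed Shrikhande fibre is the whole digraph -/

section Trivial

variable {V W : Type*} {Γ : Digraph V} {D : Digraph W} {e : (ZMod 4 × ZMod 4) × W ≃ V}

theorem twoWayDist_boxProd (hΓ : Γ.IsCommWDR)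
    (h : IsBoxProd (addCayley (generators : Set (ZMod 4 × ZMod 4))) D Γ e)
    (a a' : ZMod 4 × ZMod 4) (w w' : W) :
    Γ.twoWayDist (e (a, w)) (e (a', w')) =
      (length (a' - a) + D.dist w w', length (a - a') + D.dist w' w) := by
  rw [twoWayDist, h.dist_eq hΓ.wdr.1, h.dist_eq hΓ.wdr.1, dist_cayley, dist_cayley]

/-- Pairs at two-way distance `(3, 3)`: one inside a Shrikhande fibre, one obtained by adding an
undirected edge of the other factor to a pair at distance `(2, 2)`. Only the second one is joined by
a path of type `((1, 1), (2, 2))`. -/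
theorem twoWayDist_ne_one_one [Finite V] (hΓ : Γ.IsCommWDR)
    (h : IsBoxProd (addCayley (generators : Set (ZMod 4 × ZMod 4))) D Γ e) (x y : V) :
    Γ.twoWayDist x y ≠ (1, 1) := by
  intro hxy
  obtain ⟨⟨a, u⟩, rfl⟩ := e.surjective x
  obtain ⟨⟨b, v⟩, rfl⟩ := e.surjective y
  have hsmall : ∀ g, length g ≤ 1 → length (-g) ≤ 1 → g = 0 := by decide
  rw [hΓ.twoWayDist_boxProd h, Prod.mk.injEq] at hxy
  obtain ⟨h1, h2⟩ := hxy
  have hba := hsmall (b - a) (by omega) (by rw [neg_sub]; omega)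
  obtain rfl : b = a := sub_eq_zero.1 hba
  have l0 : length 0 = 0 := by decide
  rw [sub_self, l0, zero_add] at h1 h2
  have e1 : Γ.twoWayDist (e (0, u)) (e (0, v)) = (1, 1) := by
    rw [hΓ.twoWayDist_boxProd h, h1, h2]; decide
  have e2 : Γ.twoWayDist (e (0, v)) (e ((2, 0), v)) = (2, 2) := by
    rw [hΓ.twoWayDist_boxProd h, dist_self]; decide
  have e3 : Γ.twoWayDist (e (0, u)) (e ((2, 0), v)) = (3, 3) := by
    rw [hΓ.twoWayDist_boxProd h, h1, h2]; decide
  have e4 : Γ.twoWayDist (e (0, u)) (e ((1, -1), u)) = (3, 3) := by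
    rw [hΓ.twoWayDist_boxProd h, dist_self]; decide
  obtain ⟨z, hz1, hz2⟩ := hΓ.exists_transfer e1 e2 (e4.trans e3.symm)
  obtain ⟨⟨p, w⟩, rfl⟩ := e.surjective z
  rw [hΓ.twoWayDist_boxProd h, Prod.mk.injEq] at hz1 hz2
  have hp := hsmall (p - 0) (by omega) (by rw [neg_sub]; omega)
  rw [sub_zero] at hp
  subst hp
  have l3 : length ((1, -1) - 0) = 3 := by decide
  omega

/-- Pairs at two-way distance `(3, 3)`: one inside a Shrikhande fibre, one obtained by adding an arc
of the fibre and a reversed arc of type `(1, 2)` of the other factor. Only the first one is joined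
by a path of type `((2, 2), (3, 3))`, except if there is a path of type `((2, 1), (1, 2))` between
vertices at distance `(2, 2)`; but such a path does not exist inside the fibre. -/
theorem dist_ne_two_of_adj [Finite V] (hΓ : Γ.IsCommWDR)
    (h : IsBoxProd (addCayley (generators : Set (ZMod 4 × ZMod 4))) D Γ e) {u v : W}
    (huv : D.dist u v = 1) : D.dist v u ≠ 2 := by
  intro hvu
  have hD : D.StronglyConnected := h.stronglyConnected_right hΓ.wdr.1
  have e1 : Γ.twoWayDist (e (0, v)) (e ((2, 0), v)) = (2, 2) := by
    rw [hΓ.twoWayDist_boxProd h, dist_self]; decide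
  have e2 : Γ.twoWayDist (e ((2, 0), v)) (e ((1, 2), v)) = (3, 3) := by
    rw [hΓ.twoWayDist_boxProd h, dist_self]; decide
  have e3 : Γ.twoWayDist (e (0, v)) (e ((1, 2), v)) = (3, 3) := by
    rw [hΓ.twoWayDist_boxProd h, dist_self]; decide
  have e4 : Γ.twoWayDist (e (0, v)) (e ((1, 0), u)) = (3, 3) := by
    rw [hΓ.twoWayDist_boxProd h, huv, hvu]; decide
  obtain ⟨z, hz1, hz2⟩ := hΓ.exists_transfer e1 e2 (e4.trans e3.symm)
  obtain ⟨⟨p, w⟩, rfl⟩ := e.surjective z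
  rw [hΓ.twoWayDist_boxProd h, Prod.mk.injEq, sub_zero, zero_sub] at hz1
  rw [hΓ.twoWayDist_boxProd h, Prod.mk.injEq] at hz2
  by_cases hwv : w = v
  · subst hwv
    rw [dist_self, add_zero, add_zero] at hz1
    rw [huv, hvu] at hz2
    have hno : ∀ p : ZMod 4 × ZMod 4, length p = 2 → length (-p) = 2 →
      ¬ (length ((1, 0) - p) = 1 ∧ length (p - (1, 0)) = 2) := by decide
    exact hno p hz1.1 hz1.2 ⟨by omega, by omega⟩
  have d1 := mt hD.dist_eq_zero.1 hwv
  have d2 := mt hD.dist_eq_zero.1 (Ne.symm hwv)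
  have hsmall : ∀ g, length g ≤ 1 → length (-g) ≤ 1 → g = 0 := by decide
  obtain rfl := hsmall p (by omega) (by omega)
  have l0 : length 0 = 0 := by decide
  have l1 : length ((1, 0) - 0) = 1 := by decide
  have l2 : length (0 - (1, 0)) = 2 := by decide
  rw [neg_zero, l0] at hz1
  rw [l1, l2] at hz2
  have f1 : Γ.twoWayDist (e (0, v)) (e (0, u)) = (2, 1) := by
    rw [hΓ.twoWayDist_boxProd h, huv, hvu]; decide
  have f2 : Γ.twoWayDist (e (0, u)) (e (0, w)) = (1, 2) := by
    rw [hΓ.twoWayDist_boxProd h, sub_self, l0]; ext <;> simp only <;> omega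
  have f3 : Γ.twoWayDist (e (0, v)) (e (0, w)) = (2, 2) := by
    rw [hΓ.twoWayDist_boxProd h, sub_self, l0]; ext <;> simp only <;> omega
  obtain ⟨z, hz3, hz4⟩ := hΓ.exists_transfer f1 f2 (e1.trans f3.symm)
  obtain ⟨⟨p, w'⟩, rfl⟩ := e.surjective z
  rw [hΓ.twoWayDist_boxProd h, Prod.mk.injEq, sub_zero, zero_sub] at hz3
  rw [hΓ.twoWayDist_boxProd h, Prod.mk.injEq] at hz4
  -- the path stays in the fibre, since a step of it is an arc and `2s` has length two
  have hno : ∀ p : ZMod 4 × ZMod 4, length (-p) ≤ 1 → length ((2, 0) - p) ≤ 1 →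
    length (-p) = 1 ∧ length p = 2 ∧ length (p - (2, 0)) = 1 := by decide
  have := hno p (by omega) (by omega)
  omega

/-- If the arcs of a Shrikhande fibre form a Cayley digraph with connection set `generators`, then
this fibre is everything: an edge outside would belong to a Shrikhande fibre, thus would be
undirected or of type `(1, 2)`, or to a complete fibre, which contains an undirected edge. -/
theorem eq_of_directed_fibre [Finite V] (hΓ : Γ.IsCommWDR)
    (hcov : Γ.toSimpleGraphInclusive.HasDoobFibres) {K : SimpleGraph W}
    (e : shrikhandeGraph.boxProd K ≃g Γ.toSimpleGraphInclusive)
    (h : IsBoxProd (addCayley (generators : Set (ZMod 4 × ZMod 4))) D Γ e.toEquiv) (w w' : W) :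
    w = w' := by
  have hD : D.StronglyConnected := h.stronglyConnected_right hΓ.wdr.1
  have hloop : ∀ w, ¬ D.Adj w w := fun w hw =>
    hΓ.loopless _ ((h 0 w 0 w).2 (Or.inr ⟨hw, rfl⟩))
  have hfib : ∀ u v, D.Adj u v → False := by
    intro u v huv
    have l0 : length 0 = 0 := by decide
    have d1 := (hD.dist_eq_one hloop).2 huv
    have htype : Γ.twoWayDist (e (0, u)) (e (0, v)) = (1, D.dist v u) := by
      have := hΓ.twoWayDist_boxProd h 0 0 u v
      rw [sub_self, l0, d1, zero_add] at this
      simpa using this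
    have hne := hΓ.dist_ne_two_of_adj h d1
    have hadj : Γ.toSimpleGraphInclusive.Adj (e (0, u)) (e (0, v)) := by
      rw [hΓ.underlying_adj, htype]; exact Or.inl rfl
    rcases hcov _ _ hadj with ⟨F, hF, ⟨a, ha⟩, b, hb⟩ | ⟨F, hF, -⟩
    · rw [← ha, ← hb, hF.adj_iff, adj_iff] at hadj
      rw [← ha, ← hb] at htype
      have hgen : ∀ s ∈ hexagon, s ∈ generators ∨ -s ∈ generators := by decide
      have key : Γ.twoWayDist (F a) (F b) = (1, 2) ∨ Γ.twoWayDist (F b) (F a) = (1, 2) := by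
        rcases hΓ.fibre_types hF with h1 | h1 | h1
        · exact absurd (h1 0 (1, 0) (by decide)) (hΓ.twoWayDist_ne_one_one h _ _)
        · refine (hgen _ hadj).imp (fun hs => ?_) (fun hs => ?_)
          · simpa using h1 a _ hs
          · simpa using h1 b _ hs
        · refine (hgen _ hadj).symm.imp (fun hs => ?_) (fun hs => ?_)
          · simpa using h1 a _ hs
          · simpa using h1 b _ hs
      rcases key with h1 | h1
      · rw [htype, Prod.mk.injEq] at h1
        exact hne h1.2
      · rw [← twoWayDist_swap, htype] at h1
        simp at h1
    · obtain ⟨a, b, -, h11⟩ := hΓ.exists_undirected_of_complete hF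
      exact hΓ.twoWayDist_ne_one_one h _ _ h11
  obtain ⟨r, hr⟩ := hD w w'
  cases r with
  | zero => exact hr
  | succ r =>
    obtain ⟨z, hz, -⟩ := hr
    exact (hfib _ _ hz).elim

end Trivial

end Digraph.IsCommWDR

/-! ### Fibres of Doob graphs -/

theorem isFibre_boxPow {A : Type*} (G : SimpleGraph A) {n : ℕ} (x : Fin n → A) (i : Fin n) :
    IsFibre G (G.boxPow n) (Function.update x i) where
  injective := Function.update_injective x i
  adj_iff a b := by
    constructor
    · rintro ⟨j, h, -⟩
      by_cases hj : j = i
      · subst hj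
        simpa using h
      · simp [Function.update_of_ne hj] at h
    · intro h
      refine ⟨i, by simpa using h, fun j hj => ?_⟩
      rw [Function.update_of_ne hj, Function.update_of_ne hj]
  mem_range a b hab z := by
    have key : ∀ a, (G.boxPow n).Adj (Function.update x i a) z →
        a = z i ∨ ∀ j, j ≠ i → x j = z j := by
      rintro a ⟨j, -, h⟩
      by_cases hj : j = i
      · subst hj
        right
        intro k hk
        rw [← h k hk, Function.update_of_ne hk]
      · left
        simpa using h i (Ne.symm hj)
    intro h1 h2
    have hz : ∀ j, j ≠ i → x j = z j := by
      rcases key a h1 with h3 | h3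
      · rcases key b h2 with h4 | h4
        · exact absurd (h3.trans h4.symm) hab
        · exact h4
      · exact h3
    refine ⟨z i, funext fun j => ?_⟩
    by_cases hj : j = i
    · subst hj; simp
    · rw [Function.update_of_ne hj, hz j hj]

theorem IsFibre.comp {A B V : Type*} {G : SimpleGraph A} {G' : SimpleGraph B} {H : SimpleGraph V}
    {F : A → V} {F' : B → A} (hF : IsFibre G H F) (hF' : IsFibre G' G F') :
    IsFibre G' H (F ∘ F') where
  injective := hF.injective.comp hF'.injective
  adj_iff a b := (hF.adj_iff _ _).trans (hF'.adj_iff _ _)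
  mem_range a b hab z h1 h2 := by
    obtain ⟨c, rfl⟩ := hF.mem_range _ _ (hF'.injective.ne hab) z h1 h2
    obtain ⟨d, rfl⟩ := hF'.mem_range a b hab c ((hF.adj_iff _ _).1 h1) ((hF.adj_iff _ _).1 h2)
    exact ⟨d, rfl⟩

theorem isFibre_iso {V V' : Type*} {G : SimpleGraph V} {H : SimpleGraph V'} (e : G ≃g H) :
    IsFibre G H e where
  injective := e.injective
  adj_iff _ _ := e.map_adj_iff
  mem_range _ _ _ z _ _ := e.surjective z

theorem hammingGraph_eq_boxPow (d q : ℕ) :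
    hammingGraph d q = (⊤ : SimpleGraph (Fin q)).boxPow d := by
  ext x y
  change hammingDist x y = 1 ↔ ∃ i, x i ≠ y i ∧ ∀ j, j ≠ i → x j = y j
  rw [hammingDist, Finset.card_eq_one]
  refine exists_congr fun i => ?_
  rw [Finset.ext_iff]
  simp only [Finset.mem_filter, Finset.mem_univ, true_and, Finset.mem_singleton]
  constructor
  · intro h
    refine ⟨(h i).2 rfl, fun j hj => ?_⟩
    by_contra hne
    exact hj ((h j).1 hne)
  · rintro ⟨h1, h2⟩ j
    constructor
    · intro hne
      by_contra hj
      exact hne (h2 j hj)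
    · rintro rfl
      exact h1

/-- The ends of an edge of a Cartesian power lie in a common fibre. -/
theorem SimpleGraph.boxPow_adj_mem_range {A : Type*} {G : SimpleGraph A} {n : ℕ} {x y : Fin n → A}
    (h : (G.boxPow n).Adj x y) :
    ∃ i, x ∈ Set.range (Function.update x i) ∧ y ∈ Set.range (Function.update x i) := by
  obtain ⟨i, -, h⟩ := h
  refine ⟨i, ⟨x i, Function.update_eq_self i x⟩, y i, funext fun j => ?_⟩
  by_cases hj : j = i
  · subst hj; simp
  · rw [Function.update_of_ne hj, h j hj]

theorem hasDoobFibres_doobGraph (d₁ d₂ : ℕ) : (doobGraph d₁ d₂).HasDoobFibres := by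
  rintro ⟨x, x'⟩ ⟨y, y'⟩ h
  rw [doobGraph, SimpleGraph.boxProd_adj] at h
  have hleft := isFibre_of_boxProd_iso
    (SimpleGraph.Iso.refl : doobGraph d₁ d₂ ≃g doobGraph d₁ d₂) x'
  have hright := isFibre_of_boxProd_iso
    (SimpleGraph.boxProdComm _ _ : (shrikhandeGraph.boxPow d₁).boxProd (hammingGraph d₂ 4) ≃g
      doobGraph d₁ d₂) x
  rcases h with ⟨h1, h2⟩ | ⟨h1, h2⟩
  · right
    obtain rfl : x' = y' := h2
    rw [hammingGraph_eq_boxPow] at h1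
    obtain ⟨i, ⟨a, ha⟩, b, hb⟩ := SimpleGraph.boxPow_adj_mem_range h1
    have hi := isFibre_boxPow ⊤ x i
    rw [← hammingGraph_eq_boxPow] at hi
    exact ⟨_, hleft.comp hi, ⟨a, Prod.ext ha rfl⟩, b, Prod.ext hb rfl⟩
  · left
    obtain rfl : x = y := h2
    obtain ⟨i, ⟨a, ha⟩, b, hb⟩ := SimpleGraph.boxPow_adj_mem_range h1
    exact ⟨_, hright.comp (isFibre_boxPow _ x' i), ⟨a, Prod.ext rfl ha⟩, b, Prod.ext rfl hb⟩

theorem SimpleGraph.HasDoobFibres.of_iso {V V' : Type*} {G : SimpleGraph V} {H : SimpleGraph V'}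
    (hG : G.HasDoobFibres) (e : G ≃g H) : H.HasDoobFibres := by
  intro x y h
  obtain ⟨x, rfl⟩ := e.surjective x
  obtain ⟨y, rfl⟩ := e.surjective y
  rcases hG x y (e.map_adj_iff.1 h) with ⟨F, hF, ⟨a, rfl⟩, b, rfl⟩ | ⟨F, hF, ⟨a, rfl⟩, b, rfl⟩
  · exact Or.inl ⟨_, (isFibre_iso e).comp hF, ⟨a, rfl⟩, b, rfl⟩
  · exact Or.inr ⟨_, (isFibre_iso e).comp hF, ⟨a, rfl⟩, b, rfl⟩

/-- The first Shrikhande factor of a Doob graph split off. -/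
def doobGraphSplit (n d : ℕ) :
    shrikhandeGraph.boxProd ((hammingGraph d 4).boxProd (shrikhandeGraph.boxPow n)) ≃g
      doobGraph (n + 1) d where
  toFun p := (p.2.1, Fin.cons p.1 p.2.2)
  invFun q := (q.2 0, q.1, Fin.tail q.2)
  left_inv p := by simp
  right_inv q := by simp
  map_rel_iff' := by
    rintro ⟨a, x, f⟩ ⟨b, y, g⟩
    have h : (shrikhandeGraph.boxPow (n + 1)).Adj (Fin.cons a f : Fin (n + 1) → _) (Fin.cons b g) ↔
        (shrikhandeGraph.Adj a b ∧ f = g) ∨ ((shrikhandeGraph.boxPow n).Adj f g ∧ a = b) := by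
      simp only [SimpleGraph.boxPow, Fin.exists_fin_succ, Fin.forall_fin_succ, Fin.cons_zero,
        Fin.cons_succ, funext_iff, ne_eq, not_true_eq_false, Fin.succ_ne_zero, not_false_eq_true,
        IsEmpty.forall_iff, true_and, forall_const, Fin.succ_inj, (Fin.succ_ne_zero _).symm]
      refine or_congr Iff.rfl ?_
      rw [← exists_and_right]
      exact exists_congr fun i => by tauto
    change (doobGraph (n + 1) d).Adj (x, (Fin.cons a f : Fin (n + 1) → _)) (y, Fin.cons b g) ↔ _
    rw [doobGraph, SimpleGraph.boxProd_adj, SimpleGraph.boxProd_adj, SimpleGraph.boxProd_adj]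
    simp only [h, Fin.cons_inj, Prod.mk.injEq]
    tauto

/-- A graph is isomorphic to its Cartesian product with a one-vertex graph. -/
def boxProdSubsingleton {A W : Type*} [Subsingleton W] (w : W) (G : SimpleGraph A)
    (K : SimpleGraph W) : G ≃g G.boxProd K where
  toFun a := (a, w)
  invFun := Prod.fst
  left_inv _ := rfl
  right_inv p := Prod.ext rfl (Subsingleton.elim _ _)
  map_rel_iff' := by
    intro a b
    simp

namespace Shrikhande

/-- Negation as an automorphism of a Shrikhande factor. -/
def negIso {W : Type*} (K : SimpleGraph W) :
    shrikhandeGraph.boxProd K ≃g shrikhandeGraph.boxProd K where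
  toEquiv := (Equiv.neg _).prodCongr (Equiv.refl W)
  map_rel_iff' := by
    rintro ⟨a, w⟩ ⟨b, v⟩
    have h : ∀ s, -s ∈ hexagon ↔ s ∈ hexagon := by decide
    have h' : shrikhandeGraph.Adj (-a) (-b) ↔ shrikhandeGraph.Adj a b := by
      rw [adj_iff, adj_iff, ← h (b - a)]
      congr! 1
      abel
    simp [SimpleGraph.boxProd_adj, h']

theorem coe_generators :
    (generators : Set (ZMod 4 × ZMod 4)) = {(1, 0), (0, 1), (-1, -1)} := by
  simp [generators]

theorem underlying_cayley :
    (Digraph.addCayley (generators : Set (ZMod 4 × ZMod 4))).toSimpleGraphInclusive =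
      shrikhandeGraph := by
  have key : ∀ s : ZMod 4 × ZMod 4, (s ≠ 0 ∧ (s ∈ generators ∨ -s ∈ generators)) ↔ s ∈ hexagon := by
    decide
  ext a b
  rw [adj_iff, ← key, Digraph.toSimpleGraphInclusive, SimpleGraph.fromRel_adj, neg_sub, ne_comm,
    sub_ne_zero]
  simp only [Digraph.addCayley, Finset.mem_coe, neg_add_eq_sub]

end Shrikhande

open Shrikhande in
/-- If the underlying graph is a Doob graph, then a single Shrikhande fibre is the whole digraph. -/
theorem Digraph.IsCommWDR.cayley_of_doob {V : Type*} [Finite V] {Γ : Digraph V}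
    (hΓ : Γ.IsCommWDR) (hdirected : ∃ x y, Γ.Adj x y ∧ ¬ Γ.Adj y x) {n d : ℕ}
    (φ : Γ.toSimpleGraphInclusive ≃g doobGraph (n + 1) d) :
    n = 0 ∧ d = 0 ∧
      Nonempty (Γ.Adj ≃r (addCayley (generators : Set (ZMod 4 × ZMod 4))).Adj) := by
  have hcov : Γ.toSimpleGraphInclusive.HasDoobFibres :=
    (hasDoobFibres_doobGraph (n + 1) d).of_iso φ.symm
  -- the case in which the arcs of a fibre are given by `-generators` is reduced to the other one
  obtain ⟨e, he⟩ : ∃ e : shrikhandeGraph.boxProd ((hammingGraph d 4).boxProd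
      (shrikhandeGraph.boxPow n)) ≃g Γ.toSimpleGraphInclusive,
      ∀ a, ∀ s ∈ generators, Γ.twoWayDist (e (a, 0)) (e (a + s, 0)) = (1, 2) := by
    let e := (doobGraphSplit n d).trans φ.symm
    have hF := isFibre_of_boxProd_iso e 0
    rcases hΓ.fibre_types hF with h | h | h
    · obtain ⟨x, y, h1, h2⟩ := hdirected
      exact absurd (hΓ.symm_of_undirected_fibre hcov hF h h1) h2
    · exact ⟨e, h⟩
    · refine ⟨(negIso _).trans e, fun a s hs => ?_⟩
      have h1 := h (-a) s hs
      rw [← neg_add'] at h1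
      exact h1
  obtain ⟨D, hD⟩ := hΓ.isBoxProd e he
  have hW := hΓ.eq_of_directed_fibre hcov e hD
  have hn : n = 0 := by
    by_contra hn
    have h := congrArg (fun w => w.2 ⟨0, Nat.pos_of_ne_zero hn⟩) (hW (0, 0) (0, fun _ => (1, 0)))
    exact absurd (congrArg Prod.fst h) (by change (0 : ZMod 4) ≠ 1; decide)
  have hd : d = 0 := by
    by_contra hd
    have h := congrArg (fun w => w.1 ⟨0, Nat.pos_of_ne_zero hd⟩) (hW (0, 0) (fun _ => 1, 0))
    revert h
    simp
  refine ⟨hn, hd, ⟨RelIso.symm ⟨Equiv.ofBijective (fun a => e (a, 0)) ⟨?_, ?_⟩, ?_⟩⟩⟩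
  · intro a b h
    simpa using h
  · intro x
    obtain ⟨⟨a, w⟩, rfl⟩ := e.surjective x
    exact ⟨a, by rw [hW w 0]⟩
  · intro a b
    refine (hD a 0 b 0).trans ⟨?_, fun h => Or.inl ⟨h, rfl⟩⟩
    rintro (h | ⟨h, -⟩)
    · exact h.1
    · exact absurd ((hD 0 0 0 0).2 (Or.inr ⟨h, rfl⟩)) (hΓ.loopless _)

/-! ### The characterization -/

theorem theorem1p3 {V : Type*} [Finite V] [Nonempty V] (Γ : Digraph V)
    (hloopless : ∀ x, ¬ Γ.Adj x x)
    (hdirected : ∃ x y, Γ.Adj x y ∧ ¬ Γ.Adj y x)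
    (hwdr : Γ.IsWeaklyDistanceRegular) (hcomm : Γ.IsCommutative) :
    ((∃ d₁ d₂ : ℕ, 0 < d₁ ∧ Nonempty (Γ.toSimpleGraphInclusive ≃g doobGraph d₁ d₂)) ↔
      Nonempty (Γ.Adj ≃r
        (Digraph.addCayley ({(1, 0), (0, 1), (-1, -1)} : Set (ZMod 4 × ZMod 4))).Adj)) ∧
    (∀ d₁ d₂ : ℕ, 0 < d₁ → Nonempty (Γ.toSimpleGraphInclusive ≃g doobGraph d₁ d₂) →
      d₁ = 1 ∧ d₂ = 0 ∧ Nonempty (Γ.toSimpleGraphInclusive ≃g shrikhandeGraph)) := by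
  have hΓ : Γ.IsCommWDR := ⟨hloopless, hwdr, hcomm⟩
  have hdoob : shrikhandeGraph ≃g doobGraph 1 0 :=
    (boxProdSubsingleton 0 shrikhandeGraph _).trans (doobGraphSplit 0 0)
  rw [← Shrikhande.coe_generators]
  refine ⟨⟨?_, ?_⟩, ?_⟩
  · rintro ⟨d₁, d₂, hd, ⟨φ⟩⟩
    obtain ⟨n, rfl⟩ := Nat.exists_eq_add_one_of_ne_zero hd.ne'
    exact (hΓ.cayley_of_doob hdirected φ).2.2
  · rintro ⟨f⟩
    have g : Γ.toSimpleGraphInclusive ≃g shrikhandeGraph := by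
      rw [← Shrikhande.underlying_cayley]
      refine ⟨f.toEquiv, ?_⟩
      intro a b
      simp [Digraph.toSimpleGraphInclusive, SimpleGraph.fromRel_adj, f.map_rel_iff]
    exact ⟨1, 0, one_pos, ⟨g.trans hdoob⟩⟩
  · rintro d₁ d₂ hd ⟨φ⟩
    obtain ⟨n, rfl⟩ := Nat.exists_eq_add_one_of_ne_zero hd.ne'
    obtain ⟨rfl, rfl, -⟩ := hΓ.cayley_of_doob hdirected φ
    exact ⟨rfl, rfl, ⟨φ.trans hdoob.symm⟩⟩
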